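/- Let $d\ge 3$, $T\ge 1$, $L>0$, and let $f_1,f_2,\dots:\mathbb{R}^d\to\mathbb{R}$ be fixed (deterministic) convex functions with $|f_t(u)-f_t(v)|\le L\|u-v\|_1$ for all $u,v\in\mathbb{R}^d$. Let $\Theta=\{x\in\mathbb{R}^d: x\ge 0,\ \|x\|_1=1\}$ and $V(x)=\sum_{j=1}^d x_j\log x_j$ on $\Theta$ (with $0\log 0=0$). Let $\zeta_1,\zeta_2,\dots$ be independent random vectors uniformly distributed (with respect to surface measure) on the sphere $\{x\in\mathbb{R}^d:\|x\|_1=1\}$, and let the noise variables satisfy $\xi_t'=\xi_t''$ almost surely for every $t$ (canceling noise). Set $$\eta=\frac{1}{\sqrt6+\sqrt{12}}\cdot\frac{\sqrt{\log d}}{L}\cdot\sqrt{\frac{1}{dT}},\qquad 0<h\le\frac{7(d+1)\sqrt{\log d}}{100\sqrt{dT}},$$ where $h$ is otherwise arbitrary. Consider zero-order $\ell_1$-randomized online dual averaging: $z_1=0$ and, for $t=1,2,\dots$, $$x_t=\operatorname*{argmax}_{x\in\Theta}\{\eta\langle z_t,x\rangle-V(x)\},\quad y_t'=f_t(x_t+h\zeta_t)+\xi_t',\quad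 y_t''=f_t(x_t-h\zeta_t)+\xi_t'',$$ $$g_t=\frac{d}{2h}(y_t'-y_t'')\operatorname{sign}(\zeta_t),\qquad z_{t+1}=z_t-g_t,$$ where $\operatorname{sign}$ acts component-wise and equals $1$ at $0$. Then for every $x\in\Theta$ the random variable $\sum_{t=1}^T(f_t(x_t)-f_t(x))$ is integrable and $$\mathbb{E}\Big[\sum_{t=1}^T\big(f_t(x_t)-f_t(x)\big)\Big]\le 11.9\,L\sqrt{dT\log d}.$$ -/

import Mathlib

open MeasureTheory ProbabilityTheory Set
open scoped MeasureTheory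

noncomputable section

namespace ZeroOrder

/-- The `ℓ₁`-norm on `ℝ^d`. -/
def l1Norm {d : ℕ} (x : EuclideanSpace ℝ (Fin d)) : ℝ := ∑ i, |x i|

/-- The `ℓ₁`-sphere in `ℝ^d`. -/
def l1Sphere (d : ℕ) : Set (EuclideanSpace ℝ (Fin d)) := {x | l1Norm x = 1}

/-- The uniform distribution on the `ℓ₁`-sphere: the surface measure, that is, the
`(d - 1)`-dimensional Hausdorff measure for the Euclidean distance, restricted to the sphere and
normalized to total mass one. -/
def uniformL1Sphere (d : ℕ) : Measure (EuclideanSpace ℝ (Fin d)) :=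
  (μH[(d : ℝ) - 1] : Measure (EuclideanSpace ℝ (Fin d)))[|l1Sphere d]

/-- The component-wise sign, with the value `1` at `0`. -/
def signVec {d : ℕ} (x : EuclideanSpace ℝ (Fin d)) : EuclideanSpace ℝ (Fin d) :=
  WithLp.toLp 2 fun i => if 0 ≤ x i then 1 else -1

/-- The probability simplex. -/
def simplex (d : ℕ) : Set (EuclideanSpace ℝ (Fin d)) := {x | (∀ i, 0 ≤ x i) ∧ l1Norm x = 1}

/-- The negative entropy; `Real.log 0 = 0` gives the convention `0 log 0 = 0`. -/
def negEntropy {d : ℕ} (x : EuclideanSpace ℝ (Fin d)) : ℝ := ∑ i, x i * Real.log (x i)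

/-- One trajectory of zero-order `ℓ₁`-randomized online dual averaging on `Θ` with regularizer `V`,
step sizes `η t`, discretization parameters `h t`, losses `f t`, randomization `ζ t`, noises
`ξ' t`, `ξ'' t`, actions `x t`, observations `y' t`, `y'' t`, gradient estimates `g t` and dual
vectors `z t`. Rounds are numbered `t = 0, 1, 2, …`. -/
structure IsTrajectory {d : ℕ} (Θ : Set (EuclideanSpace ℝ (Fin d)))
    (V : EuclideanSpace ℝ (Fin d) → ℝ) (η h : ℕ → ℝ)
    (f : ℕ → EuclideanSpace ℝ (Fin d) → ℝ) (ζ : ℕ → EuclideanSpace ℝ (Fin d))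
    (ξ' ξ'' : ℕ → ℝ) (x : ℕ → EuclideanSpace ℝ (Fin d)) (y' y'' : ℕ → ℝ)
    (g z : ℕ → EuclideanSpace ℝ (Fin d)) : Prop where
  init : z 0 = 0
  action_mem : ∀ t, x t ∈ Θ
  action_argmax : ∀ t, IsMaxOn (fun u => η t * inner ℝ (z t) u - V u) Θ (x t)
  query_fst : ∀ t, y' t = f t (x t + h t • ζ t) + ξ' t
  query_snd : ∀ t, y'' t = f t (x t - h t • ζ t) + ξ'' t
  gradient : ∀ t, g t = ((d : ℝ) / (2 * h t) * (y' t - y'' t)) • signVec (ζ t)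
  update : ∀ t, z (t + 1) = z t - g t

end ZeroOrder

end

noncomputable section

namespace ZeroOrder

open scoped ENNReal NNReal Pointwise

variable {d : ℕ}

/-! ### The `ℓ₁`-norm -/

/-! The regret bound combines a pathwise estimate for exponential weights with two estimates for the
two-point gradient estimator, one on its bias and one on its variance.

Pathwise: with the negative entropy on the simplex the action is forced to be `softmax η (z t)`
(`eq_softmax_of_isMaxOn`). Tracking the log-partition function gives `∑ ⟨g t, x t - u⟩ ≤ log d / η +
2 η ∑ ‖g t‖_∞ ^ 2` (`sum_inner_le_of_dualAveraging`). The noises cancel almost surely, so `g t` is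
the scalar `gradCoeff` times a vector of signs and its sup-norm is `|gradCoeff|`.

Bias: by the divergence theorem, `d` times the mean over the `ℓ₁`-sphere of `⟨sign θ, v⟩ φ θ` is the
average of the derivative of `φ` along `v` over the `ℓ₁`-ball. For convex `φ` this derivative at a
point `x` of the ball is at least `φ x - φ (x - v)`, hence at least `φ 0 - φ (-v) - 2 L`
(`sub_le_integral_inner_signVec`). After rescaling by `h` the bias is at most `2 L h` per round. The
divergence theorem is obtained from integration by parts against a radial cutoff whose layer shrinks
to the sphere.

Variance: the uniform law is invariant under coordinate sign changes. An Efron–Stein argument over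
these flips bounds the mean square of `φ θ - φ (-θ)` by `4 L ^ 2` times the mean of `∑ θ i ^ 2`,
which is at most `2 / d`. Hence `gradCoeff` has second moment at most `2 L ^ 2 d`
(`integral_gradCoeff_sq_le`).

Both facts about the uniform law rest on a polar decomposition of Lebesgue measure relative to the
Hausdorff measure of the sphere (`lintegral_radial`). Since `x t` is almost surely a function of the
earlier `ζ`, it is independent of `ζ t` and may be frozen in these estimates; summing over rounds
gives `log d / η + 4 η L ^ 2 d T + 2 L h T`. -/

lemma l1Norm_nonneg (x : EuclideanSpace ℝ (Fin d)) : 0 ≤ l1Norm x :=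
  Finset.sum_nonneg fun _ _ => abs_nonneg _

lemma l1Norm_smul (c : ℝ) (x : EuclideanSpace ℝ (Fin d)) : l1Norm (c • x) = |c| * l1Norm x := by
  simp [l1Norm, abs_mul, Finset.mul_sum]

lemma l1Norm_neg (x : EuclideanSpace ℝ (Fin d)) : l1Norm (-x) = l1Norm x := by
  simp [l1Norm]

lemma l1Norm_add_le (x y : EuclideanSpace ℝ (Fin d)) : l1Norm (x + y) ≤ l1Norm x + l1Norm y := by
  simp only [l1Norm, ← Finset.sum_add_distrib]
  exact Finset.sum_le_sum fun i _ => abs_add_le _ _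

lemma abs_apply_le_l1Norm (x : EuclideanSpace ℝ (Fin d)) (i : Fin d) : |x i| ≤ l1Norm x :=
  Finset.single_le_sum (f := fun i => |x i|) (fun _ _ => abs_nonneg _) (Finset.mem_univ i)

lemma l1Norm_eq_zero_iff {x : EuclideanSpace ℝ (Fin d)} : l1Norm x = 0 ↔ x = 0 := by
  refine ⟨fun h => ?_, fun h => by simp [h, l1Norm]⟩
  ext i
  have := abs_apply_le_l1Norm x i
  simpa using abs_nonpos_iff.1 (this.trans h.le)

lemma continuous_l1Norm : Continuous (l1Norm : EuclideanSpace ℝ (Fin d) → ℝ) := by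
  unfold l1Norm; fun_prop

lemma measurable_l1Norm : Measurable (l1Norm : EuclideanSpace ℝ (Fin d) → ℝ) :=
  continuous_l1Norm.measurable

lemma measurableSet_l1Sphere : MeasurableSet (l1Sphere d) :=
  measurable_l1Norm (measurableSet_singleton 1)

lemma l1Norm_le_norm (x : EuclideanSpace ℝ (Fin d)) : l1Norm x ≤ d * ‖x‖ := by
  have h : ∀ i ∈ Finset.univ, |x i| ≤ ‖x‖ := fun i _ => PiLp.norm_apply_le x i
  simpa [l1Norm] using Finset.sum_le_sum h

lemma norm_le_l1Norm (x : EuclideanSpace ℝ (Fin d)) : ‖x‖ ≤ l1Norm x := by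
  refine le_of_sq_le_sq ?_ (l1Norm_nonneg x)
  rw [EuclideanSpace.norm_sq_eq, sq (l1Norm x)]
  conv_rhs => rw [l1Norm, Finset.sum_mul]
  refine Finset.sum_le_sum fun i _ => ?_
  rw [Real.norm_eq_abs, sq]
  exact mul_le_mul_of_nonneg_left (abs_apply_le_l1Norm x i) (abs_nonneg _)

/-! ### Coordinate flips -/

/-- The reflection changing the signs of the coordinates in `s`. -/
def flip (s : Finset (Fin d)) : EuclideanSpace ℝ (Fin d) ≃ₗᵢ[ℝ] EuclideanSpace ℝ (Fin d) :=
  LinearIsometryEquiv.piLpCongrRight 2 fun i =>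
    if i ∈ s then LinearIsometryEquiv.neg ℝ else LinearIsometryEquiv.refl ℝ ℝ

lemma flip_apply (s : Finset (Fin d)) (x : EuclideanSpace ℝ (Fin d)) (i : Fin d) :
    flip s x i = if i ∈ s then - x i else x i := by
  by_cases h : i ∈ s <;> simp [flip, h]

lemma flip_flip (s : Finset (Fin d)) (x : EuclideanSpace ℝ (Fin d)) : flip s (flip s x) = x := by
  ext i
  by_cases h : i ∈ s <;> simp [flip_apply, h]

lemma l1Norm_flip (s : Finset (Fin d)) (x : EuclideanSpace ℝ (Fin d)) :
    l1Norm (flip s x) = l1Norm x := by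
  refine Finset.sum_congr rfl fun i _ => ?_
  by_cases h : i ∈ s <;> simp [flip_apply, h]

lemma measurable_flip (s : Finset (Fin d)) : Measurable (flip s) :=
  (flip s).continuous.measurable

/-- The open positive orthant. -/
def posOrthant (d : ℕ) : Set (EuclideanSpace ℝ (Fin d)) := {x | ∀ i, 0 < x i}

lemma measurableSet_posOrthant : MeasurableSet (posOrthant d) := by
  have : posOrthant d = ⋂ i, {x | 0 < x i} := by ext; simp [posOrthant]
  rw [this]
  exact MeasurableSet.iInter fun i => measurableSet_lt measurable_const (by fun_prop)

/-- The only flip that works is the one of the negative coordinates: the open orthants partition the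
vectors without zero coordinates. -/
lemma sum_indicator_flip {x : EuclideanSpace ℝ (Fin d)} (hx : ∀ i, x i ≠ 0) :
    ∑ s : Finset (Fin d), (posOrthant d).indicator (fun _ => (1 : ℝ≥0∞)) (flip s x) = 1 := by
  classical
  rw [Finset.sum_eq_single (Finset.univ.filter fun i => x i < 0)]
  · rw [indicator_of_mem]
    intro i
    rw [flip_apply]
    rcases (hx i).lt_or_gt with h | h
    · simp [h]
    · simp [h, h.le, not_lt.2]
  · intro s _ hs
    rw [indicator_of_notMem]
    refine fun hmem => hs ?_
    ext i
    have := hmem i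
    rw [flip_apply] at this
    by_cases h : i ∈ s
    · simpa [h] using this
    · simp only [h, if_false] at this
      simp [h, this.le]
  · simp

lemma lintegral_eq_sum_flip {ν : Measure (EuclideanSpace ℝ (Fin d))}
    (hν : ∀ s, MeasurePreserving (flip s) ν ν) (h0 : ∀ᵐ x ∂ν, ∀ i, x i ≠ 0)
    {F : EuclideanSpace ℝ (Fin d) → ℝ≥0∞} (hF : Measurable F) :
    ∫⁻ x, F x ∂ν = ∑ s : Finset (Fin d), ∫⁻ x in posOrthant d, F (flip s x) ∂ν := by
  have hterm : ∀ s : Finset (Fin d), ∫⁻ x in posOrthant d, F (flip s x) ∂ν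
      = ∫⁻ x, (posOrthant d).indicator (fun _ => (1 : ℝ≥0∞)) (flip s x) * F x ∂ν := by
    intro s
    have hm : Measurable fun x => (posOrthant d).indicator (fun _ => (1 : ℝ≥0∞)) (flip s x) * F x :=
      ((measurable_const.indicator measurableSet_posOrthant).comp (measurable_flip s)).mul hF
    rw [← (hν s).lintegral_comp hm, ← lintegral_indicator measurableSet_posOrthant]
    congr 1
    ext x
    by_cases hx : x ∈ posOrthant d <;> simp [hx, flip_flip]
  simp_rw [hterm]
  rw [← lintegral_finsetSum]
  · refine lintegral_congr_ae ?_
    filter_upwards [h0] with x hx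
    rw [← Finset.sum_mul, sum_indicator_flip hx, one_mul]
  · exact fun s _ =>
      ((measurable_const.indicator measurableSet_posOrthant).comp (measurable_flip s)).mul hF

/-! ### Polar decomposition on the positive orthant -/

/-- The sum of the coordinates. -/
def coordSum (d : ℕ) : EuclideanSpace ℝ (Fin d) →ₗ[ℝ] ℝ where
  toFun x := ∑ i, x i
  map_add' x y := by simp [Finset.sum_add_distrib]
  map_smul' c x := by simp [Finset.mul_sum]

lemma coordSum_apply (x : EuclideanSpace ℝ (Fin d)) : coordSum d x = ∑ i, x i := rfl

lemma coordSum_single (j : Fin d) : coordSum d (EuclideanSpace.single j 1) = 1 := by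
  simp [coordSum_apply, PiLp.single_apply]

lemma continuous_coordSum : Continuous (coordSum d) := LinearMap.continuous_of_finiteDimensional _

lemma l1Norm_eq_coordSum {x : EuclideanSpace ℝ (Fin d)} (hx : ∀ i, 0 ≤ x i) :
    l1Norm x = coordSum d x :=
  Finset.sum_congr rfl fun i _ => abs_of_nonneg (hx i)

lemma finrank_ker_coordSum (hd : 0 < d) :
    Module.finrank ℝ (LinearMap.ker (coordSum d)) = d - 1 := by
  have h := LinearMap.finrank_range_add_finrank_ker (coordSum d)
  have hs : LinearMap.range (coordSum d) = ⊤ := by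
    refine LinearMap.range_eq_top.2 fun r => ⟨r • EuclideanSpace.single ⟨0, hd⟩ 1, ?_⟩
    simp [coordSum_single]
  rw [hs] at h
  simp at h
  omega

/-- The Hausdorff measure of the hyperplane of vectors with coordinates summing to zero is a Haar
measure. -/
lemma isAddHaarMeasure_ker_coordSum (hd : 0 < d) :
    (μH[(d : ℝ) - 1] : Measure (LinearMap.ker (coordSum d))).IsAddHaarMeasure := by
  have h : ((Module.finrank ℝ (LinearMap.ker (coordSum d)) : ℕ) : ℝ) = (d : ℝ) - 1 := by
    rw [finrank_ker_coordSum hd]; push_cast [Nat.one_le_iff_ne_zero.2 hd.ne']; rfl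
  rw [← h]
  infer_instance

/-- Splitting a vector into a vector of zero sum and a multiple of a basis vector. -/
def kerProdEquiv (j : Fin d) : (LinearMap.ker (coordSum d) × ℝ) ≃L[ℝ] EuclideanSpace ℝ (Fin d) :=
  LinearEquiv.toContinuousLinearEquiv
    { toFun := fun p => (p.1 : EuclideanSpace ℝ (Fin d)) + p.2 • EuclideanSpace.single j (1 : ℝ)
      invFun := fun x => (⟨x - coordSum d x • EuclideanSpace.single j 1, by
        simp [coordSum_single]⟩, coordSum d x)
      map_add' := fun p q => by simp only [Prod.fst_add, Prod.snd_add, Submodule.coe_add]; module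
      map_smul' := fun c p => by
        simp only [Prod.smul_fst, Prod.smul_snd, Submodule.coe_smul, RingHom.id_apply,
          smul_eq_mul]
        module
      left_inv := fun p => by
        have hp : coordSum d (p.1 : EuclideanSpace ℝ (Fin d)) = 0 := p.1.2
        ext1
        · ext1
          simp [hp, coordSum_single]
        · simp [hp, coordSum_single]
      right_inv := fun x => by simp }

lemma kerProdEquiv_apply (j : Fin d) (p : LinearMap.ker (coordSum d) × ℝ) :
    kerProdEquiv j p = (p.1 : EuclideanSpace ℝ (Fin d)) + p.2 • EuclideanSpace.single j (1 : ℝ) :=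
  rfl

lemma coordSum_kerProdEquiv (j : Fin d) (p : LinearMap.ker (coordSum d) × ℝ) :
    coordSum d (kerProdEquiv j p) = p.2 := by
  have hp : coordSum d (p.1 : EuclideanSpace ℝ (Fin d)) = 0 := p.1.2
  simp [kerProdEquiv_apply, hp, coordSum_single]

lemma isometry_add_single (j : Fin d) :
    Isometry fun v : LinearMap.ker (coordSum d) =>
      (v : EuclideanSpace ℝ (Fin d)) + EuclideanSpace.single j 1 :=
  (IsometryEquiv.addRight (EuclideanSpace.single j (1 : ℝ))).isometry.comp isometry_subtype_coe

lemma range_add_single (j : Fin d) :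
    range (fun v : LinearMap.ker (coordSum d) =>
      (v : EuclideanSpace ℝ (Fin d)) + EuclideanSpace.single j 1) = {x | coordSum d x = 1} := by
  ext x
  constructor
  · rintro ⟨v, rfl⟩
    have hp : coordSum d (v : EuclideanSpace ℝ (Fin d)) = 0 := v.2
    simp [hp, coordSum_single]
  · intro hx
    have hx : coordSum d x = 1 := hx
    exact ⟨⟨x - EuclideanSpace.single j 1, by simp [hx, coordSum_single]⟩, by simp⟩

lemma lintegral_ker_add_single (hd : 0 < d) (j : Fin d)
    {F : EuclideanSpace ℝ (Fin d) → ℝ≥0∞} (hF : Measurable F) :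
    ∫⁻ v : LinearMap.ker (coordSum d), 
      F ((v : EuclideanSpace ℝ (Fin d)) + EuclideanSpace.single j (1 : ℝ)) ∂μH[(d : ℝ) - 1]
      = ∫⁻ x in {x | coordSum d x = 1}, F x ∂μH[(d : ℝ) - 1] := by
  have h1 : (0 : ℝ) ≤ (d : ℝ) - 1 := by
    have : (1 : ℝ) ≤ d := by exact_mod_cast hd
    linarith
  rw [← range_add_single j, ← (isometry_add_single j).map_hausdorffMeasure (Or.inl h1),
    lintegral_map hF (isometry_add_single j).continuous.measurable]

lemma volume_eq_smul_map_kerProdEquiv (hd : 0 < d) (j : Fin d) :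
    ∃ c : ℝ≥0, (volume : Measure (EuclideanSpace ℝ (Fin d))) = c • Measure.map (kerProdEquiv j)
      ((μH[(d : ℝ) - 1] : Measure (LinearMap.ker (coordSum d))).prod volume) := by
  have := isAddHaarMeasure_ker_coordSum hd
  have : (Measure.map (kerProdEquiv j) ((μH[(d : ℝ) - 1] :
      Measure (LinearMap.ker (coordSum d))).prod volume)).IsAddHaarMeasure :=
    (kerProdEquiv j).isAddHaarMeasure_map _
  exact ⟨_, Measure.isAddLeftInvariant_eq_smul _ _⟩

/-- Scaling of a Haar measure; on the hyperplane of zero sum it provides the Jacobian `s ^ (d - 1)`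
of polar coordinates. -/
lemma lintegral_comp_smul_haar {V : Type*} [NormedAddCommGroup V] [NormedSpace ℝ V]
    [MeasurableSpace V] [BorelSpace V] [FiniteDimensional ℝ V] (ν : Measure V)
    [ν.IsAddHaarMeasure] {F : V → ℝ≥0∞} (hF : Measurable F) {s : ℝ} (hs : 0 < s) :
    ∫⁻ v, F v ∂ν = ENNReal.ofReal (s ^ Module.finrank ℝ V) * ∫⁻ v, F (s • v) ∂ν := by
  have h := Measure.map_addHaar_smul ν hs.ne'
  have h2 : ∫⁻ v, F (s • v) ∂ν = ∫⁻ v, F v ∂(Measure.map (s • ·) ν) :=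
    (lintegral_map hF (measurable_const_smul s)).symm
  rw [h2, h, lintegral_smul_measure, smul_eq_mul, ← mul_assoc, ← ENNReal.ofReal_mul (by positivity),
    abs_of_pos (by positivity), mul_inv_cancel₀ (by positivity), ENNReal.ofReal_one, one_mul]

/-- On the positive orthant the `ℓ₁`-norm is linear, so its level sets are parallel slices and
Fubini applies. The constant `c` comes from uniqueness of Haar measure and stays unspecified,
because only normalized integrals matter later. -/
lemma lintegral_posOrthant (hd : 0 < d) :
    ∃ c : ℝ≥0∞, ∀ (a : ℝ → ℝ≥0∞) (b : EuclideanSpace ℝ (Fin d) → ℝ≥0∞), Measurable a →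
      Measurable b →
      ∫⁻ x in posOrthant d, a (coordSum d x) * b ((coordSum d x)⁻¹ • x)
        = c * (∫⁻ s in Ioi (0 : ℝ), ENNReal.ofReal (s ^ (d - 1)) * a s)
          * ∫⁻ x in posOrthant d, b x ∂(μH[(d : ℝ) - 1].restrict {x | coordSum d x = 1}) := by
  have j : Fin d := ⟨0, hd⟩
  have := isAddHaarMeasure_ker_coordSum hd
  obtain ⟨c, hc⟩ := volume_eq_smul_map_kerProdEquiv hd j
  have hmS := (continuous_coordSum (d := d)).measurable
  refine ⟨c, fun a b ha hb => ?_⟩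
  have hG : Measurable ((posOrthant d).indicator
      fun x => a (coordSum d x) * b ((coordSum d x)⁻¹ • x)) :=
    ((ha.comp hmS).mul (hb.comp (by fun_prop))).indicator measurableSet_posOrthant
  have hG' : Measurable fun p => (posOrthant d).indicator
      (fun x => a (coordSum d x) * b ((coordSum d x)⁻¹ • x)) (kerProdEquiv j p) :=
    hG.comp (kerProdEquiv j).continuous.measurable
  have hB : Measurable ((posOrthant d).indicator b) := hb.indicator measurableSet_posOrthant
  rw [← lintegral_indicator measurableSet_posOrthant, hc, lintegral_smul_measure,
    lintegral_map hG (kerProdEquiv j).continuous.measurable,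
    lintegral_prod_symm' _ hG']
  rw [ENNReal.smul_def, smul_eq_mul, mul_assoc]
  congr 1
  rw [← lintegral_indicator measurableSet_posOrthant, ← lintegral_ker_add_single hd j hB,
    ← lintegral_mul_const _ (by fun_prop), ← lintegral_indicator measurableSet_Ioi]
  congr 1
  ext s
  by_cases hs : s ∈ Ioi (0 : ℝ)
  · have hs' : 0 < s := hs
    -- Substituting `s • v` for `v` sends the slice at height `s` to `s` times the slice at height
    -- one, so the direction no longer depends on `s`.
    rw [indicator_of_mem hs, lintegral_comp_smul_haar _ _ hs', finrank_ker_coordSum hd, mul_assoc,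
      ← lintegral_const_mul (a s) (by fun_prop)]
    · congr 2
      ext v
      have hv : coordSum d (kerProdEquiv j (s • v, s)) = s := coordSum_kerProdEquiv j _
      have he : kerProdEquiv j (s • v, s)
          = s • ((v : EuclideanSpace ℝ (Fin d)) + EuclideanSpace.single j 1) := by
        simp [kerProdEquiv_apply]
      have hmem : kerProdEquiv j (s • v, s) ∈ posOrthant d ↔
          (v : EuclideanSpace ℝ (Fin d)) + EuclideanSpace.single j 1 ∈ posOrthant d := by
        rw [he]
        refine forall_congr' fun i => ?_
        rw [PiLp.smul_apply, smul_eq_mul, mul_pos_iff_of_pos_left hs']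
      by_cases hp : (v : EuclideanSpace ℝ (Fin d)) + EuclideanSpace.single j 1 ∈ posOrthant d
      · rw [indicator_of_mem (hmem.2 hp), indicator_of_mem hp, hv, he, smul_smul,
          inv_mul_cancel₀ hs'.ne', one_smul]
      · rw [indicator_of_notMem (mt hmem.1 hp), indicator_of_notMem hp, mul_zero]
    · exact hG.comp ((kerProdEquiv j).continuous.measurable.comp (by fun_prop))
  · rw [indicator_of_notMem hs]
    refine (lintegral_congr fun v => ?_).trans lintegral_zero
    refine indicator_of_notMem (fun hmem => hs ?_) _
    have hv : coordSum d (kerProdEquiv j (v, s)) = s := coordSum_kerProdEquiv j _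
    rw [mem_Ioi, ← hv]
    exact Finset.sum_pos (fun i _ => hmem i) ⟨j, Finset.mem_univ j⟩

/-! ### The uniform distribution on the `ℓ₁`-sphere -/

/-- A coordinate, as a linear map. -/
def coordMap (i : Fin d) : EuclideanSpace ℝ (Fin d) →ₗ[ℝ] ℝ where
  toFun x := x i
  map_add' _ _ := rfl
  map_smul' _ _ := rfl

@[simp] lemma coordMap_apply (i : Fin d) (x : EuclideanSpace ℝ (Fin d)) : coordMap i x = x i := rfl

lemma ae_volume_apply_ne_zero :
    ∀ᵐ x : EuclideanSpace ℝ (Fin d), ∀ i, x i ≠ 0 := by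
  refine ae_all_iff.2 fun i => ?_
  let K : Submodule ℝ (EuclideanSpace ℝ (Fin d)) :=
    LinearMap.ker (coordMap i)
  have hK : K ≠ ⊤ := by
    intro h
    have : EuclideanSpace.single i (1 : ℝ) ∈ K := h ▸ Submodule.mem_top
    simp [K] at this
  have := Measure.addHaar_submodule (volume : Measure (EuclideanSpace ℝ (Fin d))) K hK
  rw [ae_iff]
  convert this using 2
  ext x
  simp [K]

/-- On one face the set is a translate of a proper subspace of the hyperplane, hence null for its
Haar measure; flips carry the face to all the others. -/
lemma hausdorffMeasure_l1Sphere_inter_coord (hd : 2 ≤ d) (i : Fin d) :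
    (μH[(d : ℝ) - 1] : Measure (EuclideanSpace ℝ (Fin d))) (l1Sphere d ∩ {x | x i = 0}) = 0 := by
  have : Nontrivial (Fin d) := Fin.nontrivial_iff_two_le.2 hd
  -- Translating by a basis vector with `j ≠ i` leaves the coordinate `i` unchanged, so the
  -- condition `x i = 0` stays linear.
  obtain ⟨j, hj⟩ := exists_ne i
  have h1 : (0 : ℝ) ≤ (d : ℝ) - 1 := by
    have : (2 : ℝ) ≤ d := by exact_mod_cast hd
    linarith
  have := isAddHaarMeasure_ker_coordSum (d := d) (by omega)
  let K : Submodule ℝ (LinearMap.ker (coordSum d)) :=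
    LinearMap.ker ((coordMap i).comp
      (LinearMap.ker (coordSum d)).subtype)
  have hK : K ≠ ⊤ := by
    intro h
    have hm : EuclideanSpace.single i (1 : ℝ) - EuclideanSpace.single j 1
        ∈ LinearMap.ker (coordSum d) := by simp [coordSum_single]
    have : (⟨_, hm⟩ : LinearMap.ker (coordSum d)) ∈ K := h ▸ Submodule.mem_top
    simp [K, hj.symm] at this
  have hK0 := Measure.addHaar_submodule (μH[(d : ℝ) - 1]) K hK
  have hface : (μH[(d : ℝ) - 1] : Measure (EuclideanSpace ℝ (Fin d)))
      ({x | coordSum d x = 1} ∩ {x | x i = 0}) = 0 := by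
    rw [← (isometry_add_single j).hausdorffMeasure_image (Or.inl h1)] at hK0
    refine measure_mono_null ?_ hK0
    rintro x ⟨hx, hxi⟩
    have hx : coordSum d x = 1 := hx
    have hxi : x i = 0 := hxi
    refine ⟨⟨x - EuclideanSpace.single j 1, by simp [hx, coordSum_single]⟩, ?_, by simp⟩
    simp [K, hxi, hj.symm]
  have hsub : l1Sphere d ∩ {x | x i = 0} ⊆ ⋃ s : Finset (Fin d),
      flip s '' ({x | coordSum d x = 1} ∩ {x | x i = 0}) := by
    classical
    rintro x ⟨hx, hxi⟩
    have hx : l1Norm x = 1 := hx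
    have hxi : x i = 0 := hxi
    refine mem_iUnion.2 ⟨Finset.univ.filter fun k => x k < 0, flip _ x, ⟨?_, ?_⟩, flip_flip _ _⟩
    · change coordSum d _ = 1
      rw [← l1Norm_eq_coordSum, l1Norm_flip, hx]
      intro k
      rw [flip_apply]
      by_cases h : x k < 0
      · simp [h, h.le]
      · simp [h, not_lt.1 h]
    · simp [flip_apply, hxi]
  refine measure_mono_null hsub (measure_iUnion_null fun s => ?_)
  rw [(flip s).isometry.hausdorffMeasure_image (Or.inl h1), hface]

lemma measurePreserving_flip_restrict (s : Finset (Fin d)) :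
    MeasurePreserving (flip s)
      ((μH[(d : ℝ) - 1] : Measure (EuclideanSpace ℝ (Fin d))).restrict (l1Sphere d))
      ((μH[(d : ℝ) - 1] : Measure (EuclideanSpace ℝ (Fin d))).restrict (l1Sphere d)) := by
  have h := ((flip s).toIsometryEquiv.measurePreserving_hausdorffMeasure
    ((d : ℝ) - 1)).restrict_preimage (measurableSet_l1Sphere (d := d))
  have hp : (flip s).toIsometryEquiv ⁻¹' l1Sphere d = l1Sphere d := by
    ext x
    simp [l1Sphere, l1Norm_flip]
  rw [hp] at h
  exact h

lemma measurePreserving_flip_uniformL1Sphere (s : Finset (Fin d)) :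
    MeasurePreserving (flip s) (uniformL1Sphere d) (uniformL1Sphere d) :=
  (measurePreserving_flip_restrict s).smul_measure _

lemma ae_restrict_l1Sphere_apply_ne_zero (hd : 2 ≤ d) :
    ∀ᵐ x ∂((μH[(d : ℝ) - 1] : Measure (EuclideanSpace ℝ (Fin d))).restrict (l1Sphere d)),
      ∀ i, x i ≠ 0 := by
  refine ae_all_iff.2 fun i => ?_
  rw [ae_restrict_iff' measurableSet_l1Sphere, ae_iff]
  convert hausdorffMeasure_l1Sphere_inter_coord hd i using 2
  ext x
  simp

lemma ae_uniformL1Sphere_l1Norm : ∀ᵐ x ∂(uniformL1Sphere d), l1Norm x = 1 :=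
  Measure.ae_smul_measure (ae_restrict_mem measurableSet_l1Sphere) _

lemma exists_lintegral_radial (hd : 2 ≤ d) :
    ∃ c : ℝ≥0∞, ∀ (a : ℝ → ℝ≥0∞) (b : EuclideanSpace ℝ (Fin d) → ℝ≥0∞), Measurable a →
      Measurable b →
      ∫⁻ x, a (l1Norm x) * b ((l1Norm x)⁻¹ • x)
        = c * (∫⁻ s in Ioi (0 : ℝ), ENNReal.ofReal (s ^ (d - 1)) * a s)
          * ∫⁻ x in l1Sphere d, b x ∂(μH[(d : ℝ) - 1]) := by
  obtain ⟨c, hc⟩ := lintegral_posOrthant (d := d) (by omega)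
  refine ⟨c, fun a b ha hb => ?_⟩
  have hm := measurable_l1Norm (d := d)
  have hF : Measurable fun x : EuclideanSpace ℝ (Fin d) =>
      a (l1Norm x) * b ((l1Norm x)⁻¹ • x) := (ha.comp hm).mul (hb.comp (by fun_prop))
  rw [lintegral_eq_sum_flip (fun s => (flip s).measurePreserving) ae_volume_apply_ne_zero hF,
    lintegral_eq_sum_flip measurePreserving_flip_restrict
      (ae_restrict_l1Sphere_apply_ne_zero hd) hb, Finset.mul_sum]
  refine Finset.sum_congr rfl fun s _ => ?_
  have hset : ((μH[(d : ℝ) - 1] : Measure (EuclideanSpace ℝ (Fin d))).restrict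
      (l1Sphere d)).restrict (posOrthant d)
      = ((μH[(d : ℝ) - 1] : Measure (EuclideanSpace ℝ (Fin d))).restrict
        {x | coordSum d x = 1}).restrict (posOrthant d) := by
    rw [Measure.restrict_restrict measurableSet_posOrthant,
      Measure.restrict_restrict measurableSet_posOrthant]
    congr 1
    ext x
    refine and_congr_right fun hx => ?_
    change l1Norm x = 1 ↔ coordSum d x = 1
    rw [l1Norm_eq_coordSum fun i => (hx i).le]
  rw [hset, ← hc a (fun x => b (flip s x)) ha (hb.comp (measurable_flip s))]
  refine setLIntegral_congr_fun measurableSet_posOrthant fun x hx => ?_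
  rw [l1Norm_flip, l1Norm_eq_coordSum fun i => (hx i).le, map_smul]

/-- Under a radial density with respect to Lebesgue measure, the direction is uniformly distributed
and independent of the radius. -/
theorem lintegral_radial (hd : 2 ≤ d) [IsProbabilityMeasure (uniformL1Sphere d)]
    {a : ℝ → ℝ≥0∞} {b : EuclideanSpace ℝ (Fin d) → ℝ≥0∞} (ha : Measurable a)
    (hb : Measurable b) :
    ∫⁻ x, a (l1Norm x) * b ((l1Norm x)⁻¹ • x)
      = (∫⁻ x : EuclideanSpace ℝ (Fin d), a (l1Norm x)) * ∫⁻ x, b x ∂(uniformL1Sphere d) := by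
  obtain ⟨c, hc⟩ := exists_lintegral_radial hd
  have hσ : ∀ b : EuclideanSpace ℝ (Fin d) → ℝ≥0∞, ∫⁻ x, b x ∂(uniformL1Sphere d)
      = (μH[(d : ℝ) - 1] (l1Sphere d))⁻¹ * ∫⁻ x in l1Sphere d, b x ∂(μH[(d : ℝ) - 1]) := by
    intro b
    rw [uniformL1Sphere, ProbabilityTheory.cond, lintegral_smul_measure, smul_eq_mul]
  have h1 := hc a (fun _ => 1) ha measurable_const
  -- Total mass one says that the Hausdorff mass of the sphere times its inverse is `1`; the mass
  -- itself never has to be computed.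
  have hone := hσ fun _ => 1
  simp only [lintegral_const, measure_univ, mul_one, Measure.restrict_apply, MeasurableSet.univ,
    univ_inter, one_mul] at h1 hone
  rw [h1, hc a b ha hb, hσ]
  calc _ = c * (∫⁻ s in Ioi (0 : ℝ), ENNReal.ofReal (s ^ (d - 1)) * a s)
      * (((μH[(d : ℝ) - 1] (l1Sphere d))⁻¹ * (μH[(d : ℝ) - 1] (l1Sphere d)))
        * ∫⁻ x in l1Sphere d, b x ∂(μH[(d : ℝ) - 1])) := by rw [← hone, one_mul]
    _ = _ := by ring

/-! ### Second moment of the uniform distribution on the `ℓ₁`-sphere -/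

lemma integral_pow_mul_exp_neg (n : ℕ) :
    ∫ t in Ioi (0 : ℝ), t ^ n * Real.exp (-t) = n.factorial := by
  rw [← Real.Gamma_nat_eq_factorial, Real.Gamma_eq_integral (by positivity)]
  refine setIntegral_congr_fun measurableSet_Ioi fun t _ => ?_
  simp [mul_comm]

lemma integral_abs_pow_mul_exp_neg_abs (n : ℕ) :
    ∫ t : ℝ, |t| ^ n * Real.exp (-|t|) = 2 * n.factorial := by
  rw [integral_comp_abs (f := fun t : ℝ => t ^ n * Real.exp (-t)), integral_pow_mul_exp_neg]

lemma integrable_abs_pow_mul_exp_neg_abs (n : ℕ) :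
    Integrable (fun t : ℝ => |t| ^ n * Real.exp (-|t|)) := by
  by_contra h
  have h1 := integral_abs_pow_mul_exp_neg_abs n
  -- The integral of a non-integrable function is `0` by convention, but the value found is
  -- positive.
  rw [integral_undef h] at h1
  have : (0 : ℝ) < n.factorial := by exact_mod_cast n.factorial_pos
  linarith

lemma lintegral_prod_abs_pow_mul_exp_neg_abs (n : Fin d → ℕ) :
    ∫⁻ x : EuclideanSpace ℝ (Fin d), ENNReal.ofReal (∏ k, |x k| ^ n k * Real.exp (-|x k|))
      = ENNReal.ofReal (2 ^ d * ∏ k, ((n k).factorial : ℝ)) := by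
  have h := (EuclideanSpace.volume_preserving_symm_measurableEquiv_toLp (Fin d)).lintegral_comp_emb
    (MeasurableEquiv.measurableEmbedding _)
    (fun y : Fin d → ℝ => ENNReal.ofReal (∏ k, |y k| ^ n k * Real.exp (-|y k|)))
  refine h.trans ?_
  rw [← ofReal_integral_eq_lintegral_ofReal]
  · rw [integral_fintype_prod_volume_eq_prod (fun k (t : ℝ) => |t| ^ n k * Real.exp (-|t|))]
    simp [integral_abs_pow_mul_exp_neg_abs, Finset.prod_mul_distrib]
  · exact Integrable.fintype_prod (f := fun k (t : ℝ) => |t| ^ n k * Real.exp (-|t|))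
      fun k => integrable_abs_pow_mul_exp_neg_abs (n k)
  · exact Filter.Eventually.of_forall fun y => Finset.prod_nonneg fun k _ => by positivity

lemma exp_neg_l1Norm (x : EuclideanSpace ℝ (Fin d)) :
    Real.exp (-l1Norm x) = ∏ k, Real.exp (-|x k|) := by
  rw [l1Norm, ← Finset.sum_neg_distrib, Real.exp_sum]

lemma lintegral_abs_mul_abs_mul_exp_neg_l1Norm (i j : Fin d) :
    ∫⁻ x : EuclideanSpace ℝ (Fin d), ENNReal.ofReal (|x i| * |x j| * Real.exp (-l1Norm x))
      = ENNReal.ofReal (2 ^ d * ∏ k, (((if k = i then 1 else 0) + (if k = j then 1 else 0) :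
        ℕ).factorial : ℝ)) := by
  rw [← lintegral_prod_abs_pow_mul_exp_neg_abs]
  refine lintegral_congr fun x => ?_
  simp only [pow_add, Finset.prod_mul_distrib, exp_neg_l1Norm]
  congr 3 <;> simp [pow_ite]

/-- The weight `s ^ 2 * exp (-s)` makes both sides of the radial formula products of one-dimensional
Gamma integrals: the homogeneous numerator is `∑ x i ^ 2` against `exp (-‖x‖₁)`, the denominator is
`‖x‖₁ ^ 2` against the same density. -/
lemma lintegral_sum_sq_uniformL1Sphere (hd : 2 ≤ d)
    [IsProbabilityMeasure (uniformL1Sphere d)] :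
    ∫⁻ x, ENNReal.ofReal (∑ i, x i ^ 2) ∂(uniformL1Sphere d) ≤ ENNReal.ofReal (2 / d) := by
  have hd0 : (0 : ℝ) < d := by exact_mod_cast (by omega : 0 < d)
  have hrad := lintegral_radial hd (a := fun s => ENNReal.ofReal (s ^ 2 * Real.exp (-s)))
    (b := fun x => ENNReal.ofReal (∑ i, x i ^ 2)) (by fun_prop) (by fun_prop)
  have hm := measurable_l1Norm (d := d)
  have hmeas : ∀ i j : Fin d, Measurable fun x : EuclideanSpace ℝ (Fin d) =>
      ENNReal.ofReal (|x i| * |x j| * Real.exp (-l1Norm x)) := by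
    intro i j
    have h1 : ∀ i : Fin d, Measurable fun x : EuclideanSpace ℝ (Fin d) => |x i| := fun i =>
      Continuous.measurable (by fun_prop)
    exact ENNReal.measurable_ofReal.comp
      (((h1 i).mul (h1 j)).mul (Real.measurable_exp.comp hm.neg))
  have hleft : ∫⁻ x : EuclideanSpace ℝ (Fin d), ENNReal.ofReal (l1Norm x ^ 2 *
      Real.exp (-l1Norm x)) * ENNReal.ofReal (∑ i, ((l1Norm x)⁻¹ • x) i ^ 2)
      = ENNReal.ofReal (2 ^ d * (2 * d)) := by
    calc _ = ∫⁻ x : EuclideanSpace ℝ (Fin d), ∑ i,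
          ENNReal.ofReal (|x i| * |x i| * Real.exp (-l1Norm x)) := by
          refine lintegral_congr fun x => ?_
          rw [← ENNReal.ofReal_sum_of_nonneg fun i _ => by positivity,
            ← ENNReal.ofReal_mul (by positivity)]
          congr 1
          rcases eq_or_ne x 0 with rfl | hx
          · simp [l1Norm]
          · have : l1Norm x ≠ 0 := mt l1Norm_eq_zero_iff.1 hx
            simp only [PiLp.smul_apply, smul_eq_mul, mul_pow, ← Finset.mul_sum, abs_mul_abs_self,
              ← Finset.sum_mul]
            field_simp
      _ = ∑ i : Fin d, ENNReal.ofReal (2 ^ d * 2) := by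
          rw [lintegral_finsetSum _ fun i _ => hmeas i i]
          refine Finset.sum_congr rfl fun i _ => ?_
          rw [lintegral_abs_mul_abs_mul_exp_neg_l1Norm, Finset.prod_eq_single i]
          · simp
          · intro k _ hk
            simp [hk]
          · simp
      _ = _ := by
          rw [← ENNReal.ofReal_sum_of_nonneg fun i _ => by positivity]
          congr 1
          simp
          ring
  -- Each of the `d ^ 2` pairs contributes at least `2 ^ d`; the extra factor `2` on the diagonal is
  -- dropped.
  have hright : ENNReal.ofReal (2 ^ d * (d * d)) ≤
      ∫⁻ x : EuclideanSpace ℝ (Fin d), ENNReal.ofReal (l1Norm x ^ 2 * Real.exp (-l1Norm x)) := by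
    calc _ = ∑ i : Fin d, ∑ j : Fin d, ENNReal.ofReal (2 ^ d) := by
          rw [ENNReal.ofReal_mul (by positivity)]
          simp [ENNReal.ofReal_mul]
          ring
      _ ≤ ∑ i : Fin d, ∑ j : Fin d, ∫⁻ x : EuclideanSpace ℝ (Fin d),
          ENNReal.ofReal (|x i| * |x j| * Real.exp (-l1Norm x)) := by
          refine Finset.sum_le_sum fun i _ => Finset.sum_le_sum fun j _ => ?_
          rw [lintegral_abs_mul_abs_mul_exp_neg_l1Norm]
          refine ENNReal.ofReal_le_ofReal (le_mul_of_one_le_right (by positivity) ?_)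
          exact_mod_cast Finset.prod_pos fun k _ => Nat.factorial_pos _
      _ = _ := by
          have hsum : ∀ x : EuclideanSpace ℝ (Fin d),
              ENNReal.ofReal (l1Norm x ^ 2 * Real.exp (-l1Norm x))
                = ∑ i, ∑ j, ENNReal.ofReal (|x i| * |x j| * Real.exp (-l1Norm x)) := by
            intro x
            rw [sq, l1Norm, Finset.sum_mul_sum, Finset.sum_mul,
              ENNReal.ofReal_sum_of_nonneg fun i _ => mul_nonneg
                (Finset.sum_nonneg fun j _ => by positivity) (Real.exp_pos _).le]
            refine Finset.sum_congr rfl fun i _ => ?_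
            rw [Finset.sum_mul, ENNReal.ofReal_sum_of_nonneg fun j _ => by positivity]
          simp_rw [hsum]
          rw [lintegral_finsetSum _ fun i _ => Finset.measurable_fun_sum _ fun j _ => hmeas i j]
          exact Finset.sum_congr rfl fun i _ => (lintegral_finsetSum _ fun j _ => hmeas i j).symm
  rw [hleft] at hrad
  have hle := (mul_le_mul_left hright _).trans_eq hrad.symm
  have h0 : ENNReal.ofReal (2 ^ d * (d * d)) ≠ 0 := by
    rw [Ne, ENNReal.ofReal_eq_zero, not_le]; positivity
  have hle' := (ENNReal.le_div_iff_mul_le (Or.inl h0) (Or.inl ENNReal.ofReal_ne_top)).2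
    ((mul_comm _ _).trans_le hle)
  refine hle'.trans_eq ?_
  rw [← ENNReal.ofReal_div_of_pos (by positivity)]
  congr 1
  field_simp

lemma integral_sum_sq_uniformL1Sphere (hd : 2 ≤ d)
    [IsProbabilityMeasure (uniformL1Sphere d)] :
    ∫ x, ∑ i, x i ^ 2 ∂(uniformL1Sphere d) ≤ 2 / d := by
  rw [integral_eq_lintegral_of_nonneg_ae
    (Filter.Eventually.of_forall fun x => Finset.sum_nonneg fun i _ => sq_nonneg _)
    (Continuous.aestronglyMeasurable (by fun_prop))]
  exact ENNReal.toReal_le_of_le_ofReal (by positivity) (lintegral_sum_sq_uniformL1Sphere hd)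

/-! ### Balls, spheres and annuli of the `ℓ₁`-norm -/

/-- The closed `ℓ₁`-ball around the origin. -/
def l1Ball (d : ℕ) (r : ℝ) : Set (EuclideanSpace ℝ (Fin d)) := {x | l1Norm x ≤ r}

lemma measurableSet_l1Ball (r : ℝ) : MeasurableSet (l1Ball d r) :=
  measurable_l1Norm measurableSet_Iic

lemma l1Ball_subset_closedBall (r : ℝ) : l1Ball d r ⊆ Metric.closedBall 0 r := fun x hx => by
  rw [mem_closedBall_zero_iff]
  exact (norm_le_l1Norm x).trans hx

lemma volume_l1Ball_ne_top (r : ℝ) : volume (l1Ball d r) ≠ ⊤ :=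
  ((measure_mono (l1Ball_subset_closedBall r)).trans_lt
    (isCompact_closedBall (0 : EuclideanSpace ℝ (Fin d)) r).measure_lt_top).ne

lemma volume_real_l1Ball {r : ℝ} (hr : 0 < r) :
    volume.real (l1Ball d r) = r ^ d * volume.real (l1Ball d 1) := by
  have h : l1Ball d r = r • l1Ball d 1 := by
    ext x
    rw [mem_smul_set_iff_inv_smul_mem₀ hr.ne']
    change l1Norm x ≤ r ↔ l1Norm (r⁻¹ • x) ≤ 1
    rw [l1Norm_smul, abs_inv, abs_of_pos hr]
    rw [inv_mul_le_iff₀ hr, mul_one]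
  rw [h, measureReal_def, Measure.addHaar_smul, ENNReal.toReal_mul, measureReal_def,
    ENNReal.toReal_ofReal (abs_nonneg _), finrank_euclideanSpace_fin, abs_of_pos (pow_pos hr d)]

lemma volume_real_l1Ball_one_pos : 0 < volume.real (l1Ball d 1) := by
  refine ENNReal.toReal_pos ?_ (volume_l1Ball_ne_top 1)
  have ho : IsOpen {x : EuclideanSpace ℝ (Fin d) | l1Norm x < 1} :=
    isOpen_lt continuous_l1Norm continuous_const
  exact ((ho.measure_pos volume ⟨0, by simp [l1Norm]⟩).trans_le
    (measure_mono fun x (hx : l1Norm x < 1) => (hx.le : l1Norm x ≤ 1))).ne'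

/-- The part of the `ℓ₁`-ball of radius `1 + ε` outside of the unit ball. -/
def annulus (d : ℕ) (ε : ℝ) : Set (EuclideanSpace ℝ (Fin d)) := {x | l1Norm x ∈ Ioc 1 (1 + ε)}

lemma measurableSet_annulus (ε : ℝ) : MeasurableSet (annulus d ε) :=
  measurable_l1Norm measurableSet_Ioc

lemma annulus_subset_l1Ball (ε : ℝ) : annulus d ε ⊆ l1Ball d (1 + ε) := fun _ hx => hx.2

lemma volume_annulus_ne_top (ε : ℝ) : volume (annulus d ε) ≠ ⊤ :=
  ((measure_mono (annulus_subset_l1Ball ε)).trans_lt (volume_l1Ball_ne_top _).lt_top).ne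

lemma volume_real_annulus {ε : ℝ} (hε : 0 < ε) :
    volume.real (annulus d ε) = ((1 + ε) ^ d - 1) * volume.real (l1Ball d 1) := by
  have h : annulus d ε = l1Ball d (1 + ε) \ l1Ball d 1 := by
    ext x
    change 1 < l1Norm x ∧ l1Norm x ≤ 1 + ε ↔ l1Norm x ≤ 1 + ε ∧ ¬ l1Norm x ≤ 1
    rw [not_le]
    exact and_comm
  have hsub : l1Ball d 1 ⊆ l1Ball d (1 + ε) := fun x (hx : l1Norm x ≤ 1) =>
    (by linarith : l1Norm x ≤ 1 + ε)
  rw [h, measureReal_sdiff hsub (measurableSet_l1Ball 1)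
    (volume_l1Ball_ne_top _), volume_real_l1Ball (by linarith)]
  ring

/-- The radial formula reduces this to the nullity of a single radius on the half-line. -/
lemma ae_volume_l1Norm_ne (hd : 2 ≤ d) (r : ℝ) :
    ∀ᵐ x : EuclideanSpace ℝ (Fin d), l1Norm x ≠ r := by
  obtain ⟨c, hc⟩ := exists_lintegral_radial hd
  have h := hc (indicator {r} fun _ => 1) (fun _ => 1)
    (measurable_const.indicator (measurableSet_singleton r)) measurable_const
  have h0 : ∫⁻ s in Ioi (0 : ℝ), ENNReal.ofReal (s ^ (d - 1)) *
      indicator {r} (fun _ => (1 : ℝ≥0∞)) s = 0 := by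
    refine (lintegral_congr_ae (g := fun _ => 0) ?_).trans lintegral_zero
    refine ae_restrict_of_ae ?_
    filter_upwards [compl_mem_ae_iff.2 (measure_singleton (μ := volume) r)] with s hs
    simp [indicator_of_notMem hs]
  rw [h0, mul_zero, zero_mul] at h
  have hi : ∀ x : EuclideanSpace ℝ (Fin d), indicator {r} (fun _ => (1 : ℝ≥0∞)) (l1Norm x) * 1
      = indicator {x | l1Norm x = r} 1 x := by
    intro x
    by_cases hx : l1Norm x = r <;> simp [hx]
  simp_rw [hi] at h
  have hms : MeasurableSet {x : EuclideanSpace ℝ (Fin d) | l1Norm x = r} :=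
    measurable_l1Norm (measurableSet_singleton r)
  rw [lintegral_indicator_one hms] at h
  rw [ae_iff]
  simpa using h

lemma map_normalize_restrict_annulus (hd : 2 ≤ d) [IsProbabilityMeasure (uniformL1Sphere d)]
    (ε : ℝ) :
    Measure.map (fun x : EuclideanSpace ℝ (Fin d) => (l1Norm x)⁻¹ • x)
      (volume.restrict (annulus d ε)) = volume (annulus d ε) • uniformL1Sphere d := by
  have hm := measurable_l1Norm (d := d)
  have hn : Measurable fun x : EuclideanSpace ℝ (Fin d) => (l1Norm x)⁻¹ • x := by fun_prop
  have ha : Measurable (indicator (Ioc 1 (1 + ε)) fun _ : ℝ => (1 : ℝ≥0∞)) :=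
    measurable_const.indicator measurableSet_Ioc
  ext A hA
  rw [Measure.map_apply hn hA, Measure.restrict_apply (hn hA), Measure.smul_apply, smul_eq_mul,
    ← lintegral_indicator_one hA, ← lintegral_indicator_one ((hn hA).inter
      (measurableSet_annulus ε)), ← lintegral_indicator_one (measurableSet_annulus ε)]
  have h := lintegral_radial hd ha (measurable_one.indicator hA : Measurable (indicator A 1))
  refine Eq.trans ?_ h
  refine lintegral_congr fun x => ?_
  by_cases h1 : l1Norm x ∈ Ioc 1 (1 + ε) <;> by_cases h2 : (l1Norm x)⁻¹ • x ∈ A <;>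
    simp [annulus, h1, h2, -mem_Ioc]

lemma setIntegral_annulus_normalize (hd : 2 ≤ d) [IsProbabilityMeasure (uniformL1Sphere d)]
    (ε : ℝ) {ψ : EuclideanSpace ℝ (Fin d) → ℝ} (hψ : Measurable ψ) :
    ∫ x in annulus d ε, ψ ((l1Norm x)⁻¹ • x)
      = volume.real (annulus d ε) * ∫ x, ψ x ∂(uniformL1Sphere d) := by
  have hm := measurable_l1Norm (d := d)
  have hn : Measurable fun x : EuclideanSpace ℝ (Fin d) => (l1Norm x)⁻¹ • x := by fun_prop
  rw [← integral_map hn.aemeasurable hψ.aestronglyMeasurable, map_normalize_restrict_annulus hd,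
    integral_smul_measure, smul_eq_mul, measureReal_def]

/-! ### Lipschitz functions and the sign vector -/

/-- The Euclidean constant is crude but enters no bound: it only gives measurability, almost
everywhere differentiability and integration by parts. -/
lemma lipschitzWith_of_l1Norm {φ : EuclideanSpace ℝ (Fin d) → ℝ} {L : ℝ} (hL : 0 ≤ L)
    (hφ : ∀ u v, |φ u - φ v| ≤ L * l1Norm (u - v)) : LipschitzWith (L * d).toNNReal φ := by
  refine LipschitzWith.of_dist_le' fun x y => ?_
  rw [Real.dist_eq, dist_eq_norm, mul_assoc]
  exact (hφ x y).trans (mul_le_mul_of_nonneg_left (l1Norm_le_norm _) hL)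

lemma lipschitzWith_l1Norm :
    LipschitzWith (1 * d : ℝ).toNNReal (l1Norm : EuclideanSpace ℝ (Fin d) → ℝ) := by
  refine lipschitzWith_of_l1Norm zero_le_one fun u v => ?_
  rw [one_mul, abs_sub_le_iff]
  constructor
  · have := l1Norm_add_le (u - v) v
    rw [sub_add_cancel] at this
    linarith
  · have := l1Norm_add_le (v - u) u
    rw [sub_add_cancel, ← neg_sub, l1Norm_neg] at this
    linarith

lemma signVec_apply (x : EuclideanSpace ℝ (Fin d)) (i : Fin d) :
    signVec x i = if 0 ≤ x i then 1 else -1 := rfl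

lemma abs_signVec_apply (x : EuclideanSpace ℝ (Fin d)) (i : Fin d) : |signVec x i| = 1 := by
  rw [signVec_apply]
  split_ifs <;> simp

lemma measurable_signVec : Measurable (signVec : EuclideanSpace ℝ (Fin d) → _) := by
  refine (MeasurableEquiv.toLp 2 (Fin d → ℝ)).measurable.comp (measurable_pi_lambda _ fun i => ?_)
  exact Measurable.ite (measurableSet_le measurable_const (by fun_prop)) measurable_const
    measurable_const

lemma signVec_smul {c : ℝ} (hc : 0 < c) (x : EuclideanSpace ℝ (Fin d)) :
    signVec (c • x) = signVec x := by
  ext i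
  rw [signVec_apply, signVec_apply, PiLp.smul_apply, smul_eq_mul]
  simp only [mul_nonneg_iff_of_pos_left hc]

lemma inner_eq_sum (x y : EuclideanSpace ℝ (Fin d)) : inner ℝ x y = ∑ i, x i * y i := by
  simp [PiLp.inner_apply, mul_comm]

lemma abs_inner_le_of_abs_le {x : EuclideanSpace ℝ (Fin d)} {M : ℝ} (hx : ∀ i, |x i| ≤ M)
    (y : EuclideanSpace ℝ (Fin d)) : |inner ℝ x y| ≤ M * l1Norm y := by
  rw [inner_eq_sum, l1Norm, Finset.mul_sum]
  refine (Finset.abs_sum_le_sum_abs _ _).trans (Finset.sum_le_sum fun i _ => ?_)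
  rw [abs_mul]
  exact mul_le_mul_of_nonneg_right (hx i) (abs_nonneg _)

lemma abs_inner_signVec_le (x v : EuclideanSpace ℝ (Fin d)) :
    |inner ℝ (signVec x) v| ≤ l1Norm v := by
  simpa using abs_inner_le_of_abs_le (fun i => (abs_signVec_apply x i).le) v

lemma hasDerivAt_l1Norm_line {x : EuclideanSpace ℝ (Fin d)} (hx : ∀ i, x i ≠ 0)
    (v : EuclideanSpace ℝ (Fin d)) :
    HasDerivAt (fun t : ℝ => l1Norm (x + t • v)) (inner ℝ (signVec x) v) 0 := by
  rw [inner_eq_sum]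
  refine HasDerivAt.fun_sum fun i _ => ?_
  have h1 : HasDerivAt (fun t : ℝ => x i + t * v i) (v i) 0 := by
    simpa using ((hasDerivAt_id (0 : ℝ)).mul_const (v i)).const_add (x i)
  have h2 : HasDerivAt (fun s : ℝ => |s|) (signVec x i) (x i + 0 * v i) := by
    rw [zero_mul, add_zero]
    convert hasDerivAt_abs (hx i) using 1
    rw [signVec_apply]
    rcases (hx i).lt_or_gt with h | h
    · simp [h]
    · simp [h, h.le]
  exact h2.comp (0 : ℝ) h1

/-! ### Integration by parts against a radial cutoff -/

/-- The cutoff equal to `1` on the unit ball, decreasing linearly to `0` at radius `1 + ε`. -/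
def cutoff (ε s : ℝ) : ℝ := max 0 (min 1 ((1 + ε - s) / ε))

lemma cutoff_nonneg (ε s : ℝ) : 0 ≤ cutoff ε s := le_max_left _ _

lemma cutoff_le_one (ε s : ℝ) : cutoff ε s ≤ 1 := max_le zero_le_one (min_le_left _ _)

lemma cutoff_of_le {ε s : ℝ} (hε : 0 < ε) (hs : s ≤ 1) : cutoff ε s = 1 := by
  have : 1 ≤ (1 + ε - s) / ε := by rw [le_div_iff₀ hε]; linarith
  rw [cutoff, min_eq_left this, max_eq_right zero_le_one]

lemma cutoff_of_ge {ε s : ℝ} (hε : 0 < ε) (hs : 1 + ε ≤ s) : cutoff ε s = 0 := by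
  have : (1 + ε - s) / ε ≤ 0 := div_nonpos_of_nonpos_of_nonneg (by linarith) hε.le
  exact max_eq_left ((min_le_right _ _).trans this)

lemma cutoff_of_mem {ε s : ℝ} (hε : 0 < ε) (hs : s ∈ Icc 1 (1 + ε)) :
    cutoff ε s = (1 + ε - s) / ε := by
  have h1 : (1 + ε - s) / ε ≤ 1 := by rw [div_le_one hε]; linarith [hs.1]
  have h0 : 0 ≤ (1 + ε - s) / ε := div_nonneg (by linarith [hs.2]) hε.le
  rw [cutoff, min_eq_right h1, max_eq_right h0]

lemma hasDerivAt_cutoff {ε s : ℝ} (hε : 0 < ε) (h1 : s ≠ 1) (h2 : s ≠ 1 + ε) :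
    HasDerivAt (cutoff ε) (indicator (Ioc 1 (1 + ε)) (fun _ => -ε⁻¹) s) s := by
  rcases h1.lt_or_gt with h | h
  · rw [indicator_of_notMem (by simp [h.le])]
    refine (hasDerivAt_const s (1 : ℝ)).congr_of_eventuallyEq ?_
    filter_upwards [Iio_mem_nhds h] with r hr using cutoff_of_le hε (le_of_lt hr)
  rcases h2.lt_or_gt with h' | h'
  · rw [indicator_of_mem (mem_Ioc.2 ⟨h, h'.le⟩)]
    have : HasDerivAt (fun r => (1 + ε - r) / ε) (-ε⁻¹) s := by
      simpa [neg_div] using ((hasDerivAt_id s).const_sub (1 + ε)).div_const ε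
    refine this.congr_of_eventuallyEq ?_
    filter_upwards [Ioo_mem_nhds h h'] with r hr
    exact cutoff_of_mem hε ⟨hr.1.le, hr.2.le⟩
  · rw [indicator_of_notMem (by simp [h'])]
    refine (hasDerivAt_const s (0 : ℝ)).congr_of_eventuallyEq ?_
    filter_upwards [Ioi_mem_nhds h'] with r hr using cutoff_of_ge hε (le_of_lt hr)

lemma exists_lipschitzWith_cutoff (ε : ℝ) : ∃ C, LipschitzWith C (cutoff ε) := by
  have h : LipschitzWith ‖ε⁻¹‖₊ fun s : ℝ => (1 + ε - s) / ε := by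
    refine LipschitzWith.of_dist_le_mul fun x y => ?_
    rw [Real.dist_eq, Real.dist_eq, coe_nnnorm, Real.norm_eq_abs, ← abs_mul, ← abs_neg]
    exact le_of_eq (congrArg _ (by ring))
  exact ⟨‖ε⁻¹‖₊, (h.const_min 1).const_max 0⟩

lemma continuous_cutoff (ε : ℝ) : Continuous (cutoff ε) :=
  (exists_lipschitzWith_cutoff ε).choose_spec.continuous

lemma hasCompactSupport_cutoff_l1Norm {ε : ℝ} (hε : 0 < ε) :
    HasCompactSupport fun x : EuclideanSpace ℝ (Fin d) => cutoff ε (l1Norm x) := by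
  refine HasCompactSupport.intro (isCompact_closedBall 0 (1 + ε)) fun x hx => ?_
  refine cutoff_of_ge hε (le_of_lt (lt_of_not_ge fun h => hx ?_))
  exact l1Ball_subset_closedBall _ h

/-- The direction `-v` is the one produced by integration by parts; its sign cancels the slope
`-ε⁻¹` of the cutoff. -/
lemma lineDeriv_cutoff_l1Norm {ε : ℝ} (hε : 0 < ε) {x : EuclideanSpace ℝ (Fin d)}
    (hx : ∀ i, x i ≠ 0) (h1 : l1Norm x ≠ 1) (h2 : l1Norm x ≠ 1 + ε)
    (v : EuclideanSpace ℝ (Fin d)) :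
    lineDeriv ℝ (fun y => cutoff ε (l1Norm y)) x (-v)
      = indicator (annulus d ε) (fun y => ε⁻¹ * inner ℝ (signVec y) v) x := by
  have hc : HasDerivAt (cutoff ε) (indicator (Ioc 1 (1 + ε)) (fun _ => -ε⁻¹) (l1Norm x))
      (l1Norm (x + (0 : ℝ) • -v)) := by
    rw [zero_smul, add_zero]
    exact hasDerivAt_cutoff hε h1 h2
  have h : HasLineDerivAt ℝ (fun y => cutoff ε (l1Norm y))
      (indicator (Ioc 1 (1 + ε)) (fun _ => -ε⁻¹) (l1Norm x) * inner ℝ (signVec x) (-v)) x (-v) :=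
    HasDerivAt.comp (h₂ := cutoff ε) (0 : ℝ) hc (hasDerivAt_l1Norm_line hx (-v))
  rw [h.lineDeriv]
  by_cases hm : l1Norm x ∈ Ioc 1 (1 + ε)
  · rw [indicator_of_mem hm, indicator_of_mem (show x ∈ annulus d ε from hm), inner_neg_right]
    ring
  · rw [indicator_of_notMem hm, indicator_of_notMem (show x ∉ annulus d ε from hm), zero_mul]

lemma integral_lineDeriv_mul_cutoff (hd : 2 ≤ d) {φ : EuclideanSpace ℝ (Fin d) → ℝ} {L ε : ℝ}
    (hL : 0 ≤ L) (hφ : ∀ u v, |φ u - φ v| ≤ L * l1Norm (u - v)) (hε : 0 < ε)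
    (v : EuclideanSpace ℝ (Fin d)) :
    ∫ x, lineDeriv ℝ φ x v * cutoff ε (l1Norm x)
      = ε⁻¹ * ∫ x in annulus d ε, inner ℝ (signVec x) v * φ x := by
  obtain ⟨C, hC⟩ := exists_lipschitzWith_cutoff ε
  have h := (lipschitzWith_of_l1Norm hL hφ).integral_lineDeriv_mul_eq (μ := volume)
    (hC.comp lipschitzWith_l1Norm) (hasCompactSupport_cutoff_l1Norm hε) v
  refine h.trans ?_
  rw [← integral_const_mul, ← integral_indicator (measurableSet_annulus ε)]
  refine integral_congr_ae ?_
  filter_upwards [ae_volume_apply_ne_zero, ae_volume_l1Norm_ne hd 1,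
    ae_volume_l1Norm_ne hd (1 + ε)] with x hx h1 h2
  have hl := lineDeriv_cutoff_l1Norm hε hx h1 h2 v
  change lineDeriv ℝ (fun y => cutoff ε (l1Norm y)) x (-v) * φ x = _
  rw [hl]
  by_cases hm : x ∈ annulus d ε
  · simp only [indicator_of_mem hm]; ring
  · simp only [indicator_of_notMem hm, zero_mul]

/-! ### The randomized gradient of a convex Lipschitz function -/

/-- The slope of a convex function of one variable over `[-1, 0]` is at most its derivative at `0`.
-/
lemma sub_le_lineDeriv {φ : EuclideanSpace ℝ (Fin d) → ℝ} (hconv : ConvexOn ℝ univ φ)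
    {x v : EuclideanSpace ℝ (Fin d)} (hx : LineDifferentiableAt ℝ φ x v) :
    φ x - φ (x - v) ≤ lineDeriv ℝ φ x v := by
  have hline : ConvexOn ℝ univ fun t : ℝ => φ (x + t • v) := by
    refine ⟨convex_univ, fun s _ t _ a b ha hb hab => ?_⟩
    have := hconv.2 (mem_univ (x + s • v)) (mem_univ (x + t • v)) ha hb hab
    refine le_trans (le_of_eq (congrArg φ ?_)) this
    obtain rfl : b = 1 - a := by linarith
    simp only [smul_eq_mul]
    module
  have h := hline.slope_le_of_hasDerivAt (mem_univ (-1)) (mem_univ 0) (by norm_num)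
    hx.hasLineDerivAt
  simpa [slope_def_field, sub_eq_add_neg] using h

lemma integral_cutoff_bounds {ε : ℝ} (hε : 0 < ε) :
    volume.real (l1Ball d 1) ≤ ∫ x : EuclideanSpace ℝ (Fin d), cutoff ε (l1Norm x) ∧
    ∫ x : EuclideanSpace ℝ (Fin d), cutoff ε (l1Norm x)
      ≤ (1 + ε) ^ d * volume.real (l1Ball d 1) := by
  have hint : Integrable fun x : EuclideanSpace ℝ (Fin d) => cutoff ε (l1Norm x) :=
    ((continuous_cutoff ε).comp continuous_l1Norm).integrable_of_hasCompactSupport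
      (hasCompactSupport_cutoff_l1Norm hε)
  have hone : ∀ r, Integrable (indicator (l1Ball d r) fun _ => (1 : ℝ)) := fun r =>
    (integrable_indicator_iff (measurableSet_l1Ball r)).2
      (integrableOn_const (volume_l1Ball_ne_top r))
  constructor
  · have h := integral_mono (hone 1) hint fun x => ?_
    · rwa [integral_indicator_const _ (measurableSet_l1Ball 1), smul_eq_mul, mul_one] at h
    · by_cases hx : x ∈ l1Ball d 1
      · rw [indicator_of_mem hx, cutoff_of_le hε hx]
      · rw [indicator_of_notMem hx]
        exact cutoff_nonneg _ _
  · have h := integral_mono hint (hone (1 + ε)) fun x => ?_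
    · rwa [integral_indicator_const _ (measurableSet_l1Ball _), smul_eq_mul, mul_one,
        volume_real_l1Ball (by linarith)] at h
    · by_cases hx : x ∈ l1Ball d (1 + ε)
      · rw [indicator_of_mem hx]
        exact cutoff_le_one _ _
      · rw [indicator_of_notMem hx, cutoff_of_ge hε (le_of_lt (lt_of_not_ge hx))]

section

variable {φ : EuclideanSpace ℝ (Fin d) → ℝ} {L ε : ℝ}

lemma le_integral_lineDeriv_mul_cutoff (hL : 0 ≤ L) (hconv : ConvexOn ℝ univ φ)
    (hφ : ∀ u v, |φ u - φ v| ≤ L * l1Norm (u - v)) (hε : 0 < ε)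
    (v : EuclideanSpace ℝ (Fin d)) :
    (φ 0 - φ (-v) - 2 * L * (1 + ε)) * ∫ x : EuclideanSpace ℝ (Fin d), cutoff ε (l1Norm x)
      ≤ ∫ x, lineDeriv ℝ φ x v * cutoff ε (l1Norm x) := by
  have hk : Continuous fun x : EuclideanSpace ℝ (Fin d) => cutoff ε (l1Norm x) :=
    (continuous_cutoff ε).comp continuous_l1Norm
  have hlip := lipschitzWith_of_l1Norm hL hφ
  have hcs := hasCompactSupport_cutoff_l1Norm (d := d) hε
  rw [← integral_const_mul]
  refine integral_mono_ae ((hk.integrable_of_hasCompactSupport hcs).const_mul _)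
    ((hlip.locallyIntegrable_lineDeriv v).integrable_smul_right_of_hasCompactSupport hk hcs) ?_
  filter_upwards [hlip.ae_lineDifferentiableAt (μ := volume) v] with x hx
  rcases le_or_gt (1 + ε) (l1Norm x) with h | h
  · simp [cutoff_of_ge hε h]
  · refine mul_le_mul_of_nonneg_right (le_trans ?_ (sub_le_lineDeriv hconv hx))
      (cutoff_nonneg _ _)
    -- Moving `x` to `0` and `x - v` to `-v` costs at most `L * (1 + ε)` each.
    have h1 := (abs_le.1 (hφ x 0)).1
    have h2 := (abs_le.1 (hφ (x - v) (-v))).2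
    rw [sub_zero] at h1
    rw [sub_neg_eq_add, sub_add_cancel] at h2
    nlinarith [mul_le_mul_of_nonneg_left h.le hL]

/-- Projecting a point of the annulus to the sphere keeps its signs and moves it by at most `ε`,
after which the integrand depends on the direction only. -/
lemma setIntegral_annulus_le (hd : 2 ≤ d) [IsProbabilityMeasure (uniformL1Sphere d)]
    (hL : 0 ≤ L) (hφ : ∀ u v, |φ u - φ v| ≤ L * l1Norm (u - v)) (hε : 0 < ε)
    (v : EuclideanSpace ℝ (Fin d)) :
    ∫ x in annulus d ε, inner ℝ (signVec x) v * φ x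
      ≤ volume.real (annulus d ε) *
        (∫ x, inner ℝ (signVec x) v * φ x ∂(uniformL1Sphere d) + L * ε * l1Norm v) := by
  have hφm : Measurable φ := (lipschitzWith_of_l1Norm hL hφ).continuous.measurable
  have hs := measurable_signVec (d := d)
  have hψ : Measurable fun x => inner ℝ (signVec x) v * φ x := (hs.inner_const).mul hφm
  have hm := measurable_l1Norm (d := d)
  have hn : Measurable fun x : EuclideanSpace ℝ (Fin d) => (l1Norm x)⁻¹ • x := by fun_prop
  have hbound : ∀ y : EuclideanSpace ℝ (Fin d), l1Norm y ≤ 1 + ε →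
      ‖inner ℝ (signVec y) v * φ y‖ ≤ l1Norm v * (|φ 0| + L * (1 + ε)) := by
    intro y hy
    rw [norm_mul, Real.norm_eq_abs, Real.norm_eq_abs]
    refine mul_le_mul (abs_inner_signVec_le _ _) ?_ (abs_nonneg _) (l1Norm_nonneg _)
    have h1 := abs_sub_abs_le_abs_sub (φ y) (φ 0)
    have h2 := hφ y 0
    rw [sub_zero] at h2
    linarith [mul_le_mul_of_nonneg_left hy hL]
  have hint : IntegrableOn (fun x => inner ℝ (signVec x) v * φ x) (annulus d ε) := by
    refine Measure.integrableOn_of_bounded (volume_annulus_ne_top ε) hψ.aestronglyMeasurable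
      (M := l1Norm v * (|φ 0| + L * (1 + ε))) ?_
    filter_upwards [ae_restrict_mem (measurableSet_annulus ε)] with x hx
    exact hbound x hx.2
  have hint' : IntegrableOn (fun x => inner ℝ (signVec ((l1Norm x)⁻¹ • x)) v *
      φ ((l1Norm x)⁻¹ • x)) (annulus d ε) := by
    refine Measure.integrableOn_of_bounded (volume_annulus_ne_top ε)
      (hψ.comp hn).aestronglyMeasurable (M := l1Norm v * (|φ 0| + L * (1 + ε))) ?_
    filter_upwards [ae_restrict_mem (measurableSet_annulus ε)] with x hx
    refine hbound _ ?_
    have hx1 : 1 < l1Norm x := hx.1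
    rw [l1Norm_smul, abs_inv, abs_of_pos (by linarith), inv_mul_cancel₀ (by linarith)]
    linarith
  have hconst : IntegrableOn (fun _ : EuclideanSpace ℝ (Fin d) => L * ε * l1Norm v)
      (annulus d ε) := integrableOn_const (volume_annulus_ne_top ε)
  calc _ ≤ ∫ x in annulus d ε, (inner ℝ (signVec ((l1Norm x)⁻¹ • x)) v *
        φ ((l1Norm x)⁻¹ • x) + L * ε * l1Norm v) := by
        refine setIntegral_mono_on hint (hint'.add hconst) (measurableSet_annulus ε)
          fun x hx => ?_
        have hx1 : 1 < l1Norm x := hx.1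
        have hx2 : l1Norm x ≤ 1 + ε := hx.2
        rw [signVec_smul (by positivity)]
        have h1 : |φ x - φ ((l1Norm x)⁻¹ • x)| ≤ L * ε := by
          refine (hφ _ _).trans (mul_le_mul_of_nonneg_left ?_ hL)
          have he : x - (l1Norm x)⁻¹ • x = (1 - (l1Norm x)⁻¹) • x := by module
          have hinv : (l1Norm x)⁻¹ ≤ 1 := inv_le_one_of_one_le₀ hx1.le
          rw [he, l1Norm_smul, abs_of_nonneg (by linarith), sub_mul,
            inv_mul_cancel₀ (by linarith)]
          linarith
        have h2 : inner ℝ (signVec x) v * (φ x - φ ((l1Norm x)⁻¹ • x)) ≤ l1Norm v * (L * ε) := by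
          refine (le_abs_self _).trans ?_
          rw [abs_mul]
          exact mul_le_mul (abs_inner_signVec_le _ _) h1 (abs_nonneg _) (l1Norm_nonneg _)
        linarith
    _ = _ := by
        rw [integral_add hint' hconst, setIntegral_annulus_normalize hd ε hψ, setIntegral_const,
          smul_eq_mul]
        ring

/-- The `ℓ₁`-randomized gradient at the origin of a convex function satisfies the gradient
inequality up to an error proportional to the Lipschitz constant. -/
theorem sub_le_integral_inner_signVec (hd : 2 ≤ d) [IsProbabilityMeasure (uniformL1Sphere d)]
    (hL : 0 ≤ L) (hconv : ConvexOn ℝ univ φ)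
    (hφ : ∀ u v, |φ u - φ v| ≤ L * l1Norm (u - v)) (v : EuclideanSpace ℝ (Fin d)) :
    φ 0 - φ (-v) - 2 * L ≤ d * ∫ x, inner ℝ (signVec x) v * φ x ∂(uniformL1Sphere d) := by
  set m := ∫ x, inner ℝ (signVec x) v * φ x ∂(uniformL1Sphere d)
  set D := φ 0 - φ (-v)
  have hV := volume_real_l1Ball_one_pos (d := d)
  -- The mass of the cutoff differs from the volume of the unit ball by at most a factor `(1 + ε) ^
  -- d`. The absolute value is needed because `D - 2 * L * (1 + ε)` may have either sign.
  have key : ∀ ε : ℝ, 0 < ε → (D - 2 * L * (1 + ε)) - |D - 2 * L * (1 + ε)| * ((1 + ε) ^ d - 1)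
      ≤ ε⁻¹ * ((1 + ε) ^ d - 1) * (m + L * ε * l1Norm v) := by
    intro ε hε
    have h1 := le_integral_lineDeriv_mul_cutoff hL hconv hφ hε v
    rw [integral_lineDeriv_mul_cutoff hd hL hφ hε v] at h1
    have h2 := mul_le_mul_of_nonneg_left (setIntegral_annulus_le hd hL hφ hε v)
      (inv_pos.2 hε).le
    rw [volume_real_annulus hε] at h2
    obtain ⟨h3, h4⟩ := integral_cutoff_bounds (d := d) hε
    refine le_of_mul_le_mul_right ?_ hV
    set V := volume.real (l1Ball d 1)
    set K := ∫ x : EuclideanSpace ℝ (Fin d), cutoff ε (l1Norm x)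
    have h5 : -|D - 2 * L * (1 + ε)| * (K - V) ≤ (D - 2 * L * (1 + ε)) * (K - V) :=
      mul_le_mul_of_nonneg_right (neg_abs_le _) (sub_nonneg.2 h3)
    have h6 : |D - 2 * L * (1 + ε)| * (K - V) ≤ |D - 2 * L * (1 + ε)| * ((1 + ε) ^ d * V - V) :=
      mul_le_mul_of_nonneg_left (by linarith) (abs_nonneg _)
    linarith
  have hleft : Filter.Tendsto (fun ε : ℝ => (D - 2 * L * (1 + ε)) -
      |D - 2 * L * (1 + ε)| * ((1 + ε) ^ d - 1)) (nhdsWithin 0 (Ioi 0)) (nhds (D - 2 * L)) := by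
    have hc : Continuous fun ε : ℝ => (D - 2 * L * (1 + ε)) -
      |D - 2 * L * (1 + ε)| * ((1 + ε) ^ d - 1) := by fun_prop
    have := (hc.tendsto 0).mono_left (nhdsWithin_le_nhds (s := Ioi 0))
    simpa using this
  -- The ratio of surface to volume: the derivative of `(1 + ε) ^ d` at `0`.
  have hslope : Filter.Tendsto (fun ε : ℝ => ε⁻¹ * ((1 + ε) ^ d - 1)) (nhdsWithin 0 (Ioi 0))
      (nhds (d : ℝ)) := by
    have h : HasDerivAt (fun ε : ℝ => (1 + ε) ^ d) (d : ℝ) 0 := by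
      simpa using ((hasDerivAt_id (0 : ℝ)).const_add 1).fun_pow d
    have := h.tendsto_slope_zero_right
    simpa using this
  have hright : Filter.Tendsto (fun ε : ℝ => ε⁻¹ * ((1 + ε) ^ d - 1) * (m + L * ε * l1Norm v))
      (nhdsWithin 0 (Ioi 0)) (nhds (d * m)) := by
    have hc : Continuous fun ε : ℝ => m + L * ε * l1Norm v := by fun_prop
    have := (hc.tendsto 0).mono_left (nhdsWithin_le_nhds (s := Ioi 0))
    simpa using hslope.mul this
  exact le_of_tendsto_of_tendsto hleft hright
    (Filter.eventually_of_mem self_mem_nhdsWithin key)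

end

/-! ### A Poincaré inequality for measures invariant under coordinate flips -/

/-- The average of a function over the flip of one coordinate. -/
def flipAvg (i : Fin d) (F : EuclideanSpace ℝ (Fin d) → ℝ) (x : EuclideanSpace ℝ (Fin d)) : ℝ :=
  (F x + F (flip {i} x)) / 2

/-- The average of a function over the flips of the coordinates in a list. -/
def flipAvgs : List (Fin d) → (EuclideanSpace ℝ (Fin d) → ℝ) → EuclideanSpace ℝ (Fin d) → ℝ
  | [], F => F
  | i :: l, F => flipAvgs l (flipAvg i F)

lemma flip_comm (s t : Finset (Fin d)) (x : EuclideanSpace ℝ (Fin d)) :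
    flip s (flip t x) = flip t (flip s x) := by
  ext i
  by_cases h : i ∈ s <;> by_cases h' : i ∈ t <;> simp [flip_apply, h, h']

lemma flip_univ (x : EuclideanSpace ℝ (Fin d)) : flip Finset.univ x = -x := by
  ext i
  simp [flip_apply]

lemma flip_insert [DecidableEq (Fin d)] {i : Fin d} {s : Finset (Fin d)} (hi : i ∉ s)
    (x : EuclideanSpace ℝ (Fin d)) : flip (insert i s) x = flip {i} (flip s x) := by
  ext k
  rcases eq_or_ne k i with rfl | hk
  · simp [flip_apply, hi]
  · simp [flip_apply, hk]

section

variable {F : EuclideanSpace ℝ (Fin d) → ℝ}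

lemma flipAvg_flip {j : Fin d} (h : ∀ x, F (flip {j} x) = F x) (i : Fin d)
    (x : EuclideanSpace ℝ (Fin d)) : flipAvg i F (flip {j} x) = flipAvg i F x := by
  rw [flipAvg, flipAvg, h, flip_comm, h]

lemma flipAvg_flip_self (i : Fin d) (x : EuclideanSpace ℝ (Fin d)) :
    flipAvg i F (flip {i} x) = flipAvg i F x := by
  rw [flipAvg, flipAvg, flip_flip, add_comm]

lemma flipAvgs_flip (l : List (Fin d)) (j : Fin d)
    (h : j ∈ l ∨ ∀ x, F (flip {j} x) = F x) (x : EuclideanSpace ℝ (Fin d)) :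
    flipAvgs l F (flip {j} x) = flipAvgs l F x := by
  induction l generalizing F with
  | nil => exact (h.resolve_left (by simp)) x
  | cons i l ih =>
    refine ih ?_
    rcases h with h | h
    · rcases List.mem_cons.1 h with rfl | h
      · exact Or.inr (flipAvg_flip_self _)
      · exact Or.inl h
    · exact Or.inr (flipAvg_flip h i)

lemma flipAvgs_neg (l : List (Fin d)) (h : ∀ x, F (-x) = - F x)
    (x : EuclideanSpace ℝ (Fin d)) : flipAvgs l F (-x) = - flipAvgs l F x := by
  induction l generalizing F with
  | nil => exact h x
  | cons i l ih =>
    refine ih fun y => ?_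
    rw [flipAvg, flipAvg, map_neg, h, h]
    ring

/-- Negation is the composition of all coordinate flips, so invariance makes the function even as
well as odd. -/
lemma eq_zero_of_neg_of_flip (h : ∀ x, F (-x) = - F x) (h' : ∀ i x, F (flip {i} x) = F x)
    (x : EuclideanSpace ℝ (Fin d)) : F x = 0 := by
  classical
  have hs : ∀ s : Finset (Fin d), ∀ x, F (flip s x) = F x := by
    intro s
    induction s using Finset.induction_on with
    | empty => exact fun x => congrArg F (by ext; simp [flip_apply])
    | insert i s hi ih => exact fun x => by rw [flip_insert hi, h', ih]
  have h1 := hs Finset.univ x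
  rw [flip_univ, h] at h1
  linarith

/-- One coordinate at a time, `(a ^ 2 + b ^ 2) / 2 = ((a + b) / 2) ^ 2 + ((a - b) / 2) ^ 2` with
`a`, `b` the values at `x` and its flip; the last term is at most `c ^ 2 * x i ^ 2`. Flips commute,
so averaging preserves the hypotheses on the remaining coordinates. -/
lemma integral_sq_le_flipAvgs {ν : Measure (EuclideanSpace ℝ (Fin d))} [IsFiniteMeasure ν]
    (hν : ∀ s, MeasurePreserving (flip s) ν ν) (hint : ∀ i, Integrable (fun x => x i ^ 2) ν)
    {M c : ℝ} (l : List (Fin d)) (hF : Measurable F) (hone : ∀ᵐ x ∂ν, l1Norm x = 1)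
    (hM : ∀ x, |F x| ≤ M * l1Norm x)
    (hc : ∀ i x, |F x - F (flip {i} x)| ≤ 2 * c * |x i|) :
    ∫ x, F x ^ 2 ∂ν ≤ ∫ x, flipAvgs l F x ^ 2 ∂ν
      + (l.map fun i => c ^ 2 * ∫ x, x i ^ 2 ∂ν).sum := by
  induction l generalizing F with
  | nil => simp [flipAvgs]
  | cons i l ih =>
    have hflip := measurable_flip (d := d) {i}
    have hF' : Measurable fun x => F (flip {i} x) := hF.comp hflip
    have hsq : ∀ {G : EuclideanSpace ℝ (Fin d) → ℝ}, Measurable G → (∀ x, |G x| ≤ M * l1Norm x) →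
        Integrable (fun x => G x ^ 2) ν := fun {G} hG hGM =>
      Integrable.of_bound (hG.pow_const 2).aestronglyMeasurable (M ^ 2)
        (hone.mono fun x hx => by
          have := hGM x
          rw [hx, mul_one] at this
          rw [norm_pow, Real.norm_eq_abs]
          exact pow_le_pow_left₀ (abs_nonneg _) this 2)
    have hM' : ∀ x, |F (flip {i} x)| ≤ M * l1Norm x := fun x => by
      rw [← l1Norm_flip {i}]
      exact hM _
    have hAm : Measurable (flipAvg i F) := (hF.add hF').div_const 2
    have hAM : ∀ x, |flipAvg i F x| ≤ M * l1Norm x := fun x => by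
      have h1 := abs_le.1 (hM x)
      have h2 := abs_le.1 (hM' x)
      rw [flipAvg, abs_le]
      constructor <;> linarith
    have hAc : ∀ j x, |flipAvg i F x - flipAvg i F (flip {j} x)| ≤ 2 * c * |x j| := fun j x => by
      have h1 := abs_le.1 (hc j x)
      have h2 := hc j (flip {i} x)
      have h3 : |flip {i} x j| = |x j| := by
        rw [flip_apply]
        split_ifs <;> simp
      rw [h3, flip_comm] at h2
      have h2 := abs_le.1 h2
      rw [flipAvg, flipAvg, abs_le]
      constructor <;> linarith
    have hi := ih hAm hAM hAc
    have hstep : ∫ x, F x ^ 2 ∂ν ≤ ∫ x, flipAvg i F x ^ 2 ∂ν + c ^ 2 * ∫ x, x i ^ 2 ∂ν := by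
      have h1 : ∫ x, F (flip {i} x) ^ 2 ∂ν = ∫ x, F x ^ 2 ∂ν :=
        (hν {i}).integral_comp (flip {i}).toHomeomorph.measurableEmbedding (fun x => F x ^ 2)
      have h2 : ∫ x, (F x ^ 2 + F (flip {i} x) ^ 2) ∂ν
          ≤ ∫ x, 2 * (flipAvg i F x ^ 2 + c ^ 2 * x i ^ 2) ∂ν := by
        refine integral_mono ((hsq hF hM).add (hsq hF' hM'))
          (((hsq hAm hAM).add ((hint i).const_mul _)).const_mul 2) fun x => ?_
        have h3 : (F x - F (flip {i} x)) ^ 2 ≤ (2 * c * |x i|) ^ 2 :=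
          sq_le_sq' (abs_le.1 (hc i x)).1 (abs_le.1 (hc i x)).2
        rw [mul_pow, sq_abs] at h3
        simp only [flipAvg]
        nlinarith
      rw [integral_add (hsq hF hM) (hsq hF' hM'), h1, integral_const_mul,
        integral_add (hsq hAm hAM) ((hint i).const_mul _), integral_const_mul] at h2
      linarith
    rw [List.map_cons, List.sum_cons]
    change _ ≤ ∫ x, flipAvgs l (flipAvg i F) x ^ 2 ∂ν + _
    linarith

/-- Poincaré inequality for odd functions and measures invariant under coordinate flips. -/
theorem integral_sq_le_of_odd {ν : Measure (EuclideanSpace ℝ (Fin d))} [IsFiniteMeasure ν]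
    (hν : ∀ s, MeasurePreserving (flip s) ν ν) (hint : ∀ i, Integrable (fun x => x i ^ 2) ν)
    {M c : ℝ} (hF : Measurable F) (hone : ∀ᵐ x ∂ν, l1Norm x = 1)
    (hM : ∀ x, |F x| ≤ M * l1Norm x) (hodd : ∀ x, F (-x) = - F x)
    (hc : ∀ i x, |F x - F (flip {i} x)| ≤ 2 * c * |x i|) :
    ∫ x, F x ^ 2 ∂ν ≤ c ^ 2 * ∫ x, ∑ i, x i ^ 2 ∂ν := by
  have h := integral_sq_le_flipAvgs hν hint Finset.univ.toList hF hone hM hc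
  have h0 : ∀ x, flipAvgs Finset.univ.toList F x = 0 :=
    eq_zero_of_neg_of_flip (flipAvgs_neg _ hodd)
      fun i => flipAvgs_flip _ i (Or.inl (by simp))
  simp only [h0, Finset.sum_map_toList] at h
  rw [integral_finsetSum _ fun i _ => hint i, Finset.mul_sum]
  simpa using h

end

lemma integrable_sq_apply_uniformL1Sphere [IsProbabilityMeasure (uniformL1Sphere d)] (i : Fin d) :
    Integrable (fun x => x i ^ 2) (uniformL1Sphere d) := by
  refine Integrable.of_bound (Continuous.aestronglyMeasurable (by fun_prop)) 1 ?_
  filter_upwards [ae_uniformL1Sphere_l1Norm] with x hx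
  have := abs_apply_le_l1Norm x i
  rw [hx] at this
  rw [norm_pow, Real.norm_eq_abs]
  exact pow_le_one₀ (abs_nonneg _) this

/-- The difference of the values of a Lipschitz function at antipodal points of the `ℓ₁`-sphere
has a mean square of order `1 / d`. -/
theorem integral_sq_sub_neg_le (hd : 2 ≤ d) [IsProbabilityMeasure (uniformL1Sphere d)]
    {φ : EuclideanSpace ℝ (Fin d) → ℝ} {L : ℝ} (hL : 0 ≤ L)
    (hφ : ∀ u v, |φ u - φ v| ≤ L * l1Norm (u - v)) :
    ∫ x, (φ x - φ (-x)) ^ 2 ∂(uniformL1Sphere d) ≤ 8 * L ^ 2 / d := by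
  have hφm : Measurable φ := (lipschitzWith_of_l1Norm hL hφ).continuous.measurable
  -- The choice `M = 2 * L` comes from `x - -x = 2 • x`. For `c`, a flip changes each of `φ x` and
  -- `φ (-x)` by at most `2 * L * |x i|`, in total `2 * (2 * L) * |x i|`.
  have h := integral_sq_le_of_odd (F := fun x => φ x - φ (-x)) (M := 2 * L) (c := 2 * L)
    measurePreserving_flip_uniformL1Sphere integrable_sq_apply_uniformL1Sphere
    (hφm.sub (hφm.comp measurable_neg)) ae_uniformL1Sphere_l1Norm (fun x => ?_)
    (fun x => by rw [neg_neg]; ring) (fun i x => ?_)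
  · refine h.trans ((mul_le_mul_of_nonneg_left (integral_sum_sq_uniformL1Sphere hd)
      (sq_nonneg _)).trans_eq ?_)
    ring
  · refine (hφ _ _).trans_eq ?_
    have : x - -x = (2 : ℝ) • x := by module
    rw [this, l1Norm_smul, abs_two]
    ring
  · have hl : l1Norm (x - flip {i} x) = 2 * |x i| := by
      rw [l1Norm, Finset.sum_eq_single i]
      · rw [PiLp.sub_apply, flip_apply, if_pos (Finset.mem_singleton_self i), sub_neg_eq_add,
          ← two_mul, abs_mul, abs_two]
      · intro j _ hj
        simp [flip_apply, hj]
      · simp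
    have h1 := abs_le.1 (hφ x (flip {i} x))
    have h2 := hφ (-x) (-flip {i} x)
    rw [neg_sub_neg, ← neg_sub x, l1Norm_neg] at h2
    have h2 := abs_le.1 h2
    rw [hl] at h1 h2
    rw [abs_le]
    constructor <;> linarith

/-! ### The two-point gradient estimator -/

/-- The scalar factor of the two-point gradient estimator at `x` in the direction `θ`. -/
def gradCoeff (f : EuclideanSpace ℝ (Fin d) → ℝ) (h : ℝ) (x θ : EuclideanSpace ℝ (Fin d)) : ℝ :=
  (d : ℝ) / (2 * h) * (f (x + h • θ) - f (x - h • θ))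

lemma measurable_gradCoeff {f : EuclideanSpace ℝ (Fin d) → ℝ} (hf : Measurable f) (h : ℝ) :
    Measurable fun p : EuclideanSpace ℝ (Fin d) × EuclideanSpace ℝ (Fin d) =>
      gradCoeff f h p.1 p.2 := by
  unfold gradCoeff
  fun_prop

section

variable {f : EuclideanSpace ℝ (Fin d) → ℝ} {L h : ℝ}

lemma abs_comp_sub_comp_le (hh : 0 < h) (hf : ∀ u v, |f u - f v| ≤ L * l1Norm (u - v))
    (x u v : EuclideanSpace ℝ (Fin d)) :
    |f (x + h • u) - f (x + h • v)| ≤ L * h * l1Norm (u - v) := by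
  refine (hf _ _).trans_eq ?_
  rw [add_sub_add_left_eq_sub, ← smul_sub, l1Norm_smul, abs_of_pos hh]
  ring

lemma abs_gradCoeff_le (hh : 0 < h) (hf : ∀ u v, |f u - f v| ≤ L * l1Norm (u - v))
    (x θ : EuclideanSpace ℝ (Fin d)) : |gradCoeff f h x θ| ≤ d * L * l1Norm θ := by
  have h1 : |f (x + h • θ) - f (x - h • θ)| ≤ L * (2 * h * l1Norm θ) := by
    refine (hf _ _).trans_eq ?_
    have : x + h • θ - (x - h • θ) = (2 * h) • θ := by module
    rw [this, l1Norm_smul, abs_of_pos (by positivity)]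
  rw [gradCoeff, abs_mul, abs_of_nonneg (by positivity)]
  refine (mul_le_mul_of_nonneg_left h1 (by positivity)).trans_eq ?_
  field_simp

lemma integral_gradCoeff_sq_le (hd : 2 ≤ d) [IsProbabilityMeasure (uniformL1Sphere d)]
    (hL : 0 ≤ L) (hh : 0 < h) (hf : ∀ u v, |f u - f v| ≤ L * l1Norm (u - v))
    (x : EuclideanSpace ℝ (Fin d)) :
    ∫ θ, gradCoeff f h x θ ^ 2 ∂(uniformL1Sphere d) ≤ 2 * L ^ 2 * d := by
  have hd0 : (0 : ℝ) < d := by exact_mod_cast (by omega : 0 < d)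
  have h1 := integral_sq_sub_neg_le hd (φ := fun y => f (x + h • y)) (L := L * h) (by positivity)
    (abs_comp_sub_comp_le hh hf x)
  have h2 : ∀ θ, gradCoeff f h x θ ^ 2
      = ((d : ℝ) / (2 * h)) ^ 2 * (f (x + h • θ) - f (x + h • -θ)) ^ 2 := fun θ => by
    rw [gradCoeff, mul_pow, smul_neg, sub_eq_add_neg x]
  simp_rw [h2]
  rw [integral_const_mul]
  refine (mul_le_mul_of_nonneg_left h1 (sq_nonneg _)).trans_eq ?_
  field_simp
  ring

/-- The gradient inequality at the origin, applied to `y ↦ f (x + h • y)`, which has constant `L *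
h`, and to its reflection; the two are averaged. -/
lemma sub_le_integral_gradCoeff_inner (hd : 2 ≤ d) [IsProbabilityMeasure (uniformL1Sphere d)]
    (hL : 0 ≤ L) (hh : 0 < h) (hconv : ConvexOn ℝ univ f)
    (hf : ∀ u v, |f u - f v| ≤ L * l1Norm (u - v)) (x u : EuclideanSpace ℝ (Fin d)) :
    f x - f u - 2 * L * h
      ≤ ∫ θ, gradCoeff f h x θ * inner ℝ (signVec θ) (x - u) ∂(uniformL1Sphere d) := by
  set v : EuclideanSpace ℝ (Fin d) := h⁻¹ • (x - u)
  have hlip := abs_comp_sub_comp_le hh hf x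
  have hlip' : ∀ a b : EuclideanSpace ℝ (Fin d),
      |f (x + h • -a) - f (x + h • -b)| ≤ L * h * l1Norm (a - b) := fun a b => by
    refine (hlip _ _).trans_eq ?_
    rw [neg_sub_neg, ← neg_sub a, l1Norm_neg]
  have hcomp : ∀ c : ℝ, ConvexOn ℝ univ fun y : EuclideanSpace ℝ (Fin d) => f (x + c • y) := by
    intro c
    refine ⟨convex_univ, fun p _ q _ a b ha hb hab => ?_⟩
    refine le_trans (le_of_eq (congrArg f ?_))
      (hconv.2 (mem_univ (x + c • p)) (mem_univ (x + c • q)) ha hb hab)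
    obtain rfl : b = 1 - a := by linarith
    module
  have hconv' : ConvexOn ℝ univ fun y : EuclideanSpace ℝ (Fin d) => f (x + h • -y) := by
    have := hcomp (-h)
    simpa only [neg_smul, smul_neg] using this
  -- The two query points are treated separately because `signVec` is not odd at vectors with a zero
  -- coordinate; with `-v` for the reflected function both bounds concern the same `u`.
  have h1 := sub_le_integral_inner_signVec hd (by positivity) (hcomp h) hlip v
  have h2 := sub_le_integral_inner_signVec hd (by positivity) hconv' hlip' (-v)
  have hv : h • v = x - u := by rw [smul_smul, mul_inv_cancel₀ hh.ne', one_smul]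
  have hu : x + h • -v = u := by rw [smul_neg, hv]; abel
  simp only [neg_neg, neg_zero, smul_zero, add_zero, hu, inner_neg_right] at h1 h2
  have hint : ∀ {φ : EuclideanSpace ℝ (Fin d) → ℝ},
      (∀ a b, |φ a - φ b| ≤ L * h * l1Norm (a - b)) →
      Integrable (fun θ => inner ℝ (signVec θ) v * φ θ) (uniformL1Sphere d) := by
    intro φ hφ
    have hφm := (lipschitzWith_of_l1Norm (by positivity) hφ).continuous.measurable
    have hs := measurable_signVec (d := d)
    refine Integrable.of_bound ((hs.inner_const).mul hφm).aestronglyMeasurable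
      (l1Norm v * (|φ 0| + L * h)) ?_
    filter_upwards [ae_uniformL1Sphere_l1Norm] with θ hθ
    rw [norm_mul, Real.norm_eq_abs, Real.norm_eq_abs]
    refine mul_le_mul (abs_inner_signVec_le _ _) ?_ (abs_nonneg _) (l1Norm_nonneg _)
    have h3 := abs_sub_abs_le_abs_sub (φ θ) (φ 0)
    have h4 := hφ θ 0
    rw [sub_zero, hθ] at h4
    linarith
  have h3 : ∫ θ, gradCoeff f h x θ * inner ℝ (signVec θ) (x - u) ∂(uniformL1Sphere d)
      = (d : ℝ) / 2 * (∫ θ, inner ℝ (signVec θ) v * f (x + h • θ) ∂(uniformL1Sphere d)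
        - ∫ θ, inner ℝ (signVec θ) v * f (x + h • -θ) ∂(uniformL1Sphere d)) := by
    rw [← integral_sub (hint hlip) (hint hlip'), ← integral_const_mul]
    refine integral_congr_ae (Filter.Eventually.of_forall fun θ => ?_)
    simp only
    rw [gradCoeff, ← hv, inner_smul_right, smul_neg, sub_eq_add_neg x]
    field_simp
  rw [h3]
  simp only [neg_mul, integral_neg] at h2
  linarith

end

lemma l1Norm_sub_le_two {x u : EuclideanSpace ℝ (Fin d)} (hx : x ∈ simplex d)
    (hu : u ∈ simplex d) : l1Norm (x - u) ≤ 2 := by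
  have h := l1Norm_add_le x (-u)
  rw [l1Norm_neg, hx.2, hu.2] at h
  rw [sub_eq_add_neg]
  linarith

/-! ### One round -/

section

variable {Ω : Type*} [MeasurableSpace Ω] {μ : Measure Ω}
  {f : EuclideanSpace ℝ (Fin d) → ℝ} {L h : ℝ} {X ζ : Ω → EuclideanSpace ℝ (Fin d)}

/-- The existence of a variable with this law already implies that the Hausdorff measure of the
sphere could be normalized. -/
lemma isProbabilityMeasure_of_hasLaw [IsProbabilityMeasure μ]
    (hζ : HasLaw ζ (uniformL1Sphere d) μ) : IsProbabilityMeasure (uniformL1Sphere d) :=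
  hζ.map_eq ▸ Measure.isProbabilityMeasure_map hζ.aemeasurable

lemma ae_l1Norm_of_hasLaw (hζ : HasLaw ζ (uniformL1Sphere d) μ) :
    ∀ᵐ ω ∂μ, l1Norm (ζ ω) = 1 := by
  have h := ae_uniformL1Sphere_l1Norm (d := d)
  rw [← hζ.map_eq] at h
  exact ae_of_ae_map hζ.aemeasurable h

variable [IsProbabilityMeasure μ]

lemma integrable_gradCoeff_sq (hL : 0 ≤ L) (hh : 0 < h)
    (hf : ∀ u v, |f u - f v| ≤ L * l1Norm (u - v)) (hX : AEMeasurable X μ)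
    (hζ : HasLaw ζ (uniformL1Sphere d) μ) :
    Integrable (fun ω => gradCoeff f h (X ω) (ζ ω) ^ 2) μ := by
  have hfm := (lipschitzWith_of_l1Norm hL hf).continuous.measurable
  refine Integrable.of_bound (((measurable_gradCoeff hfm h).comp_aemeasurable
    (hX.prodMk hζ.aemeasurable)).pow_const 2).aestronglyMeasurable ((d * L) ^ 2) ?_
  filter_upwards [ae_l1Norm_of_hasLaw hζ] with ω hω
  have := abs_gradCoeff_le hh hf (X ω) (ζ ω)
  rw [hω, mul_one] at this
  rw [norm_pow, Real.norm_eq_abs]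
  exact pow_le_pow_left₀ (abs_nonneg _) this 2

/-- Independence makes the joint law a product, so the bound for a fixed point integrates over `X`.
-/
lemma integral_gradCoeff_sq_comp_le (hd : 2 ≤ d) (hL : 0 ≤ L) (hh : 0 < h)
    (hf : ∀ u v, |f u - f v| ≤ L * l1Norm (u - v)) (hX : AEMeasurable X μ)
    (hζ : HasLaw ζ (uniformL1Sphere d) μ) (hind : IndepFun X ζ μ) :
    ∫ ω, gradCoeff f h (X ω) (ζ ω) ^ 2 ∂μ ≤ 2 * L ^ 2 * d := by
  have := isProbabilityMeasure_of_hasLaw hζ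
  have : IsProbabilityMeasure (μ.map X) := Measure.isProbabilityMeasure_map hX
  have hfm := (lipschitzWith_of_l1Norm hL hf).continuous.measurable
  have hm := (measurable_gradCoeff hfm h).pow_const 2
  have hmap := (indepFun_iff_map_prod_eq_prod_map_map hX hζ.aemeasurable).1 hind
  rw [hζ.map_eq] at hmap
  have hint : Integrable (fun p : EuclideanSpace ℝ (Fin d) × EuclideanSpace ℝ (Fin d) =>
      gradCoeff f h p.1 p.2 ^ 2) ((μ.map X).prod (uniformL1Sphere d)) := by
    rw [← hmap, integrable_map_measure hm.aestronglyMeasurable (hX.prodMk hζ.aemeasurable)]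
    exact integrable_gradCoeff_sq hL hh hf hX hζ
  calc _ = ∫ p, gradCoeff f h p.1 p.2 ^ 2 ∂((μ.map X).prod (uniformL1Sphere d)) := by
        rw [← hmap, integral_map (hX.prodMk hζ.aemeasurable) hm.aestronglyMeasurable]
    _ = ∫ x, ∫ θ, gradCoeff f h x θ ^ 2 ∂(uniformL1Sphere d) ∂(μ.map X) := integral_prod _ hint
    _ ≤ ∫ _, 2 * L ^ 2 * (d : ℝ) ∂(μ.map X) :=
        integral_mono hint.integral_prod_left (integrable_const _)
          fun x => integral_gradCoeff_sq_le hd hL hh hf x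
    _ = _ := by simp

lemma integrable_comp_sub (hL : 0 ≤ L) (hf : ∀ u v, |f u - f v| ≤ L * l1Norm (u - v))
    (hX : AEMeasurable X μ) (hXs : ∀ ω, X ω ∈ simplex d) {u : EuclideanSpace ℝ (Fin d)}
    (hu : u ∈ simplex d) : Integrable (fun ω => f (X ω) - f u) μ := by
  have hfm := (lipschitzWith_of_l1Norm hL hf).continuous.measurable
  refine Integrable.of_bound ((hfm.comp_aemeasurable hX).sub_const _).aestronglyMeasurable
    (L * 2) (Filter.Eventually.of_forall fun ω => ?_)
  exact (hf _ _).trans (mul_le_mul_of_nonneg_left (l1Norm_sub_le_two (hXs ω) hu) hL)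

lemma measurable_gradCoeff_mul_inner (hf : Measurable f) (u : EuclideanSpace ℝ (Fin d)) :
    Measurable fun p : EuclideanSpace ℝ (Fin d) × EuclideanSpace ℝ (Fin d) =>
      gradCoeff f h p.1 p.2 * inner ℝ (signVec p.2) (p.1 - u) :=
  (measurable_gradCoeff hf h).mul
    ((measurable_signVec.comp measurable_snd).inner (measurable_fst.sub_const u))

lemma integrable_gradCoeff_mul_inner (hL : 0 ≤ L) (hh : 0 < h)
    (hf : ∀ u v, |f u - f v| ≤ L * l1Norm (u - v)) (hX : AEMeasurable X μ)
    (hXs : ∀ ω, X ω ∈ simplex d) (hζ : HasLaw ζ (uniformL1Sphere d) μ)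
    {u : EuclideanSpace ℝ (Fin d)} (hu : u ∈ simplex d) :
    Integrable (fun ω => gradCoeff f h (X ω) (ζ ω) * inner ℝ (signVec (ζ ω)) (X ω - u)) μ := by
  have hfm := (lipschitzWith_of_l1Norm hL hf).continuous.measurable
  refine Integrable.of_bound ((measurable_gradCoeff_mul_inner hfm u).comp_aemeasurable
    (hX.prodMk hζ.aemeasurable)).aestronglyMeasurable (d * L * 2) ?_
  filter_upwards [ae_l1Norm_of_hasLaw hζ] with ω hω
  have := abs_gradCoeff_le hh hf (X ω) (ζ ω)
  rw [hω, mul_one] at this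
  rw [norm_mul, Real.norm_eq_abs, Real.norm_eq_abs]
  exact mul_le_mul this ((abs_inner_signVec_le _ _).trans (l1Norm_sub_le_two (hXs ω) hu))
    (abs_nonneg _) (by positivity)

lemma integral_comp_sub_le (hd : 2 ≤ d) (hL : 0 ≤ L) (hh : 0 < h) (hconv : ConvexOn ℝ univ f)
    (hf : ∀ u v, |f u - f v| ≤ L * l1Norm (u - v)) (hX : AEMeasurable X μ)
    (hXs : ∀ ω, X ω ∈ simplex d) (hζ : HasLaw ζ (uniformL1Sphere d) μ) (hind : IndepFun X ζ μ)
    {u : EuclideanSpace ℝ (Fin d)} (hu : u ∈ simplex d) :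
    ∫ ω, (f (X ω) - f u) ∂μ
      ≤ ∫ ω, gradCoeff f h (X ω) (ζ ω) * inner ℝ (signVec (ζ ω)) (X ω - u) ∂μ + 2 * L * h := by
  have := isProbabilityMeasure_of_hasLaw hζ
  have : IsProbabilityMeasure (μ.map X) := Measure.isProbabilityMeasure_map hX
  have hfm := (lipschitzWith_of_l1Norm hL hf).continuous.measurable
  have hm := measurable_gradCoeff_mul_inner (h := h) hfm u
  have hmap := (indepFun_iff_map_prod_eq_prod_map_map hX hζ.aemeasurable).1 hind
  rw [hζ.map_eq] at hmap
  have hint : Integrable (fun p : EuclideanSpace ℝ (Fin d) × EuclideanSpace ℝ (Fin d) =>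
      gradCoeff f h p.1 p.2 * inner ℝ (signVec p.2) (p.1 - u))
      ((μ.map X).prod (uniformL1Sphere d)) := by
    rw [← hmap, integrable_map_measure hm.aestronglyMeasurable (hX.prodMk hζ.aemeasurable)]
    exact integrable_gradCoeff_mul_inner hL hh hf hX hXs hζ hu
  have hfu : Measurable fun x => f x - f u := hfm.sub_const _
  have hint' : Integrable (fun x => f x - f u) (μ.map X) := by
    rw [integrable_map_measure hfu.aestronglyMeasurable hX]
    exact integrable_comp_sub hL hf hX hXs hu
  have hr : ∫ ω, gradCoeff f h (X ω) (ζ ω) * inner ℝ (signVec (ζ ω)) (X ω - u) ∂μ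
      = ∫ x, ∫ θ, gradCoeff f h x θ * inner ℝ (signVec θ) (x - u) ∂(uniformL1Sphere d)
        ∂(μ.map X) := by
    rw [← integral_prod _ hint, ← hmap,
      integral_map (hX.prodMk hζ.aemeasurable) hm.aestronglyMeasurable]
  have hl : ∫ ω, (f (X ω) - f u) ∂μ = ∫ x, (f x - f u) ∂(μ.map X) :=
    (integral_map hX hfu.aestronglyMeasurable).symm
  have hmono := integral_mono (hint'.sub (integrable_const (2 * L * h))) hint.integral_prod_left
    fun x => sub_le_integral_gradCoeff_inner hd hL hh hconv hf x u
  simp only [Pi.sub_apply] at hmono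
  rw [integral_sub hint' (integrable_const _), integral_const, probReal_univ, one_smul] at hmono
  rw [hr, hl]
  linarith

end

/-! ### Dual averaging with the negative entropy on the simplex -/

/-- The sum of the exponentials of the coordinates of `η • z`. -/
def expSum (η : ℝ) (z : EuclideanSpace ℝ (Fin d)) : ℝ := ∑ i, Real.exp (η * z i)

/-- The exponential weights associated with the dual vector `z`. -/
def softmax (η : ℝ) (z : EuclideanSpace ℝ (Fin d)) : EuclideanSpace ℝ (Fin d) :=
  WithLp.toLp 2 fun i => Real.exp (η * z i) / expSum η z

section

variable {η : ℝ} {z : EuclideanSpace ℝ (Fin d)}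

lemma softmax_apply (i : Fin d) : softmax η z i = Real.exp (η * z i) / expSum η z := rfl

lemma expSum_pos (hd : 0 < d) : 0 < expSum η z :=
  Finset.sum_pos (fun _ _ => Real.exp_pos _) ⟨⟨0, hd⟩, Finset.mem_univ _⟩

lemma softmax_pos (hd : 0 < d) (i : Fin d) : 0 < softmax η z i :=
  div_pos (Real.exp_pos _) (expSum_pos hd)

lemma sum_softmax (hd : 0 < d) : ∑ i, softmax η z i = 1 := by
  simp only [softmax_apply]
  rw [← Finset.sum_div]
  exact div_self (expSum_pos hd).ne'

lemma sum_of_mem_simplex {x : EuclideanSpace ℝ (Fin d)} (hx : x ∈ simplex d) : ∑ i, x i = 1 := by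
  rw [← coordSum_apply, ← l1Norm_eq_coordSum hx.1, hx.2]

lemma mem_simplex {x : EuclideanSpace ℝ (Fin d)} (hx : ∀ i, 0 ≤ x i) (h1 : ∑ i, x i = 1) :
    x ∈ simplex d :=
  ⟨hx, by rw [l1Norm_eq_coordSum hx, coordSum_apply, h1]⟩

lemma softmax_mem_simplex (hd : 0 < d) : softmax η z ∈ simplex d :=
  mem_simplex (fun i => (softmax_pos hd i).le) (sum_softmax hd)

lemma measurable_softmax (hd : 0 < d) :
    Measurable (softmax η : EuclideanSpace ℝ (Fin d) → EuclideanSpace ℝ (Fin d)) := by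
  have : Continuous (softmax η : EuclideanSpace ℝ (Fin d) → EuclideanSpace ℝ (Fin d)) := by
    refine (PiLp.continuous_toLp 2 _).comp (continuous_pi fun i => ?_)
    refine Continuous.div (by fun_prop) (by unfold expSum; fun_prop) fun z => (expSum_pos hd).ne'
  exact this.measurable

lemma log_softmax (hd : 0 < d) (i : Fin d) :
    Real.log (softmax η z i) = η * z i - Real.log (expSum η z) := by
  rw [softmax_apply, Real.log_div (Real.exp_pos _).ne' (expSum_pos hd).ne', Real.log_exp]

/-- Gibbs variational identity: the sum is minus the relative entropy of `x` with respect to the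
exponential weights. -/
lemma entropy_objective_eq (hd : 0 < d) {x : EuclideanSpace ℝ (Fin d)} (hx : x ∈ simplex d) :
    η * inner ℝ z x - negEntropy x
      = Real.log (expSum η z) + ∑ i, x i * (Real.log (softmax η z i) - Real.log (x i)) := by
  have h : ∀ i, x i * (Real.log (softmax η z i) - Real.log (x i))
      = η * (z i * x i) - x i * Real.log (x i) - x i * Real.log (expSum η z) := fun i => by
    rw [log_softmax hd]; ring
  simp_rw [h]
  rw [Finset.sum_sub_distrib, Finset.sum_sub_distrib, ← Finset.mul_sum, ← Finset.sum_mul,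
    sum_of_mem_simplex hx, inner_eq_sum, negEntropy]
  ring

lemma mul_log_sub_log_le {p y : ℝ} (hp : 0 < p) (hy : 0 ≤ y) :
    y * (Real.log p - Real.log y) ≤ p - y := by
  rcases hy.eq_or_lt with rfl | hy
  · simpa using hp.le
  · rw [← Real.log_div hp.ne' hy.ne']
    have := mul_le_mul_of_nonneg_left (Real.log_le_sub_one_of_pos (div_pos hp hy)) hy.le
    rwa [mul_sub, mul_div_cancel₀ _ hy.ne', mul_one] at this

lemma eq_of_mul_log_sub_log_eq {p y : ℝ} (hp : 0 < p) (hy : 0 ≤ y)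
    (h : y * (Real.log p - Real.log y) = p - y) : y = p := by
  rcases hy.eq_or_lt with rfl | hy
  · simp at h
    linarith
  · by_contra hne
    rw [← Real.log_div hp.ne' hy.ne'] at h
    have h1 : p / y ≠ 1 := fun h1 => hne ((div_eq_one_iff_eq hy.ne').1 h1).symm
    have := mul_lt_mul_of_pos_left (Real.log_lt_sub_one_of_pos (div_pos hp hy) h1) hy
    rw [mul_sub, mul_div_cancel₀ _ hy.ne', mul_one] at this
    linarith

/-- The maximizer defining the action is given by the exponential weights. -/
lemma eq_softmax_of_isMaxOn (hd : 0 < d) {x : EuclideanSpace ℝ (Fin d)} (hx : x ∈ simplex d)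
    (hmax : IsMaxOn (fun u => η * inner ℝ z u - negEntropy u) (simplex d) x) :
    x = softmax η z := by
  have h := hmax (softmax_mem_simplex (η := η) (z := z) hd)
  have h : η * inner ℝ z (softmax η z) - negEntropy (softmax η z)
      ≤ η * inner ℝ z x - negEntropy x := h
  rw [entropy_objective_eq hd hx, entropy_objective_eq hd (softmax_mem_simplex hd)] at h
  simp only [sub_self, mul_zero, Finset.sum_const_zero, add_zero, le_add_iff_nonneg_right] at h
  -- Each gap is nonnegative and, by maximality, they sum to at most zero; so all vanish, and
  -- equality in `log r ≤ r - 1` forces `r = 1`.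
  have hnn : ∀ i ∈ Finset.univ, 0 ≤ (softmax η z i - x i) -
      x i * (Real.log (softmax η z i) - Real.log (x i)) := fun i _ =>
    sub_nonneg.2 (mul_log_sub_log_le (softmax_pos hd i) (hx.1 i))
  have hsum : ∑ i, ((softmax η z i - x i) -
      x i * (Real.log (softmax η z i) - Real.log (x i))) = 0 := by
    refine le_antisymm ?_ (Finset.sum_nonneg hnn)
    rw [Finset.sum_sub_distrib, Finset.sum_sub_distrib, sum_softmax hd, sum_of_mem_simplex hx]
    linarith
  ext i
  have hi := (Finset.sum_eq_zero_iff_of_nonneg hnn).1 hsum i (Finset.mem_univ i)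
  exact eq_of_mul_log_sub_log_eq (softmax_pos hd i) (hx.1 i) (by linarith)

/-- The factor `2` covers both regimes, so no smallness of the step is required. For `η * γ ≤ 1` one
uses `exp y ≤ 1 + y + y ^ 2`; for `η * γ > 1` the trivial bound `exp (η * γ)` suffices, as `2 * (η *
γ) ≤ 2 * (η * γ) ^ 2`. -/
lemma expSum_sub_le (hd : 0 < d) (hη : 0 ≤ η) {g : EuclideanSpace ℝ (Fin d)} {γ : ℝ}
    (hg : ∀ i, |g i| ≤ γ) :
    expSum η (z - g) ≤ expSum η z *
      Real.exp (-(η * inner ℝ g (softmax η z)) + 2 * (η * γ) ^ 2) := by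
  have hS := expSum_pos (η := η) (z := z) hd
  have hsum := sum_softmax (η := η) (z := z) hd
  have hp : ∀ i, 0 ≤ softmax η z i := fun i => (softmax_pos hd i).le
  have hle : ∀ i, |-(η * g i)| ≤ η * γ := fun i => by
    rw [abs_neg, abs_mul, abs_of_nonneg hη]
    exact mul_le_mul_of_nonneg_left (hg i) hη
  have hinner : |inner ℝ g (softmax η z)| ≤ γ := by
    refine (abs_inner_le_of_abs_le hg _).trans_eq ?_
    rw [(softmax_mem_simplex hd).2, mul_one]
  have h1 : expSum η (z - g) = expSum η z * ∑ i, softmax η z i * Real.exp (-(η * g i)) := by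
    rw [Finset.mul_sum]
    refine Finset.sum_congr rfl fun i _ => ?_
    rw [softmax_apply, PiLp.sub_apply, mul_sub, sub_eq_add_neg, Real.exp_add]
    field_simp
  rw [h1]
  refine mul_le_mul_of_nonneg_left ?_ hS.le
  rcases le_or_gt (η * γ) 1 with ha | ha
  · calc ∑ i, softmax η z i * Real.exp (-(η * g i))
        ≤ ∑ i, softmax η z i * (1 - η * g i + (η * γ) ^ 2) := by
          refine Finset.sum_le_sum fun i _ => mul_le_mul_of_nonneg_left ?_ (hp i)
          have h2 := (abs_le.1 (Real.abs_exp_sub_one_sub_id_le ((hle i).trans ha))).2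
          have h3 := pow_le_pow_left₀ (abs_nonneg _) (hle i) 2
          rw [sq_abs] at h3
          linarith
      _ = 1 - η * inner ℝ g (softmax η z) + (η * γ) ^ 2 := by
          have : ∀ i, softmax η z i * (1 - η * g i + (η * γ) ^ 2)
              = softmax η z i * (1 + (η * γ) ^ 2) - η * (g i * softmax η z i) := fun i => by ring
          simp_rw [this]
          rw [Finset.sum_sub_distrib, ← Finset.sum_mul, ← Finset.mul_sum, hsum, inner_eq_sum]
          ring
      _ ≤ (-(η * inner ℝ g (softmax η z)) + 2 * (η * γ) ^ 2) + 1 := by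
          linarith [sq_nonneg (η * γ)]
      _ ≤ _ := Real.add_one_le_exp _
  · calc ∑ i, softmax η z i * Real.exp (-(η * g i))
        ≤ ∑ i, softmax η z i * Real.exp (η * γ) :=
          Finset.sum_le_sum fun i _ => mul_le_mul_of_nonneg_left
            (Real.exp_le_exp.2 ((le_abs_self _).trans (hle i))) (hp i)
      _ = Real.exp (η * γ) := by rw [← Finset.sum_mul, hsum, one_mul]
      _ ≤ _ := by
          refine Real.exp_le_exp.2 ?_
          have h2 := mul_le_mul_of_nonneg_left (abs_le.1 hinner).2 hη
          nlinarith

end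

/-- Regret bound of dual averaging with exponential weights. -/
theorem sum_inner_le_of_dualAveraging (hd : 0 < d) {η : ℝ} (hη : 0 < η)
    {z g : ℕ → EuclideanSpace ℝ (Fin d)} {γ : ℕ → ℝ} (hz : z 0 = 0)
    (hstep : ∀ t, z (t + 1) = z t - g t) (hg : ∀ t i, |g t i| ≤ γ t)
    {u : EuclideanSpace ℝ (Fin d)} (hu : u ∈ simplex d) (T : ℕ) :
    ∑ t ∈ Finset.range T, inner ℝ (g t) (softmax η (z t) - u)
      ≤ Real.log d / η + ∑ t ∈ Finset.range T, 2 * η * γ t ^ 2 := by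
  have hupper : Real.log (expSum η (z T)) ≤ Real.log d + ∑ t ∈ Finset.range T,
      (-(η * inner ℝ (g t) (softmax η (z t))) + 2 * (η * γ t) ^ 2) := by
    induction T with
    | zero => simp [hz, expSum]
    | succ T ih =>
      have h := Real.log_le_log (expSum_pos hd) (expSum_sub_le (z := z T) hd hη.le (hg T))
      rw [Real.log_mul (expSum_pos hd).ne' (Real.exp_pos _).ne', Real.log_exp] at h
      rw [hstep, Finset.sum_range_succ]
      linarith
  -- A sum of exponentials dominates each of its terms; averaging the logarithms over `u` brings in
  -- the comparator.
  have hlower : η * inner ℝ (z T) u ≤ Real.log (expSum η (z T)) := by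
    calc η * inner ℝ (z T) u = ∑ i, u i * (η * z T i) := by
          rw [inner_eq_sum, Finset.mul_sum]
          exact Finset.sum_congr rfl fun i _ => by ring
      _ ≤ ∑ i, u i * Real.log (expSum η (z T)) := by
          refine Finset.sum_le_sum fun i _ => mul_le_mul_of_nonneg_left ?_ (hu.1 i)
          rw [Real.le_log_iff_exp_le (expSum_pos hd)]
          exact Finset.single_le_sum (f := fun i => Real.exp (η * z T i))
            (fun _ _ => (Real.exp_pos _).le) (Finset.mem_univ i)
      _ = _ := by rw [← Finset.sum_mul, sum_of_mem_simplex hu, one_mul]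
  have hzT : inner ℝ (z T) u = -∑ t ∈ Finset.range T, inner ℝ (g t) u := by
    clear hupper hlower
    induction T with
    | zero => simp [hz]
    | succ T ih => rw [hstep, inner_sub_left, ih, Finset.sum_range_succ]; ring
  simp only [inner_sub_right, Finset.sum_sub_distrib]
  rw [Finset.sum_add_distrib, Finset.sum_neg_distrib, ← Finset.mul_sum] at hupper
  have h2 : ∑ t ∈ Finset.range T, 2 * (η * γ t) ^ 2
      = η * ∑ t ∈ Finset.range T, 2 * η * γ t ^ 2 := by
    rw [Finset.mul_sum]
    exact Finset.sum_congr rfl fun t _ => by ring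
  rw [h2] at hupper
  rw [hzT] at hlower
  rw [← sub_le_iff_le_add, le_div_iff₀ hη]
  linarith

/-! ### Adaptedness of the dual vectors -/

section

variable {Ω : Type*} [MeasurableSpace Ω] {μ : Measure Ω}
  {f : ℕ → EuclideanSpace ℝ (Fin d) → ℝ} {η h : ℝ} {ζ z x : ℕ → Ω → EuclideanSpace ℝ (Fin d)}

/-- Measurability of `z t` is derived, not assumed. The recursion holds only almost surely, because
the noises cancel only almost surely. -/
lemma exists_measurable_dualVector (hd : 0 < d) (hf : ∀ t, Measurable (f t))
    (hz : ∀ ω, z 0 ω = 0)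
    (hstep : ∀ t, ∀ᵐ ω ∂μ, z (t + 1) ω = z t ω
      - gradCoeff (f t) h (softmax η (z t ω)) (ζ t ω) • signVec (ζ t ω)) (t : ℕ) :
    ∃ Z : (Finset.range t → EuclideanSpace ℝ (Fin d)) → EuclideanSpace ℝ (Fin d),
      Measurable Z ∧ ∀ᵐ ω ∂μ, z t ω = Z fun i => ζ i ω := by
  induction t with
  | zero => exact ⟨fun _ => 0, measurable_const, Filter.Eventually.of_forall hz⟩
  | succ t ih =>
    obtain ⟨Z, hZ, hzZ⟩ := ih
    let past : (Finset.range (t + 1) → EuclideanSpace ℝ (Fin d)) →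
        Finset.range t → EuclideanSpace ℝ (Fin d) :=
      fun w i => w ⟨i, Finset.range_subset_range.2 t.le_succ i.2⟩
    let last : (Finset.range (t + 1) → EuclideanSpace ℝ (Fin d)) → EuclideanSpace ℝ (Fin d) :=
      fun w => w ⟨t, Finset.self_mem_range_succ t⟩
    have hpast : Measurable past := measurable_pi_lambda _ fun i => measurable_pi_apply _
    have hlast : Measurable last := measurable_pi_apply _
    have hZp := hZ.comp hpast
    refine ⟨fun w => Z (past w)
      - gradCoeff (f t) h (softmax η (Z (past w))) (last w) • signVec (last w), ?_, ?_⟩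
    · exact hZp.sub (((measurable_gradCoeff (hf t) h).comp
        (((measurable_softmax hd).comp hZp).prodMk hlast)).smul (measurable_signVec.comp hlast))
    · filter_upwards [hzZ, hstep t] with ω h1 h2
      rw [h2, h1]

lemma indepFun_softmax_dualVector (hd : 0 < d) (hf : ∀ t, Measurable (f t))
    (hζ : ∀ t, AEMeasurable (ζ t) μ) (hind : iIndepFun ζ μ) (hz : ∀ ω, z 0 ω = 0)
    (hstep : ∀ t, ∀ᵐ ω ∂μ, z (t + 1) ω = z t ω
      - gradCoeff (f t) h (softmax η (z t ω)) (ζ t ω) • signVec (ζ t ω)) (t : ℕ) :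
    AEMeasurable (fun ω => softmax η (z t ω)) μ ∧
      IndepFun (fun ω => softmax η (z t ω)) (ζ t) μ := by
  obtain ⟨Z, hZ, hzZ⟩ := exists_measurable_dualVector hd hf hz hstep t
  have hZs := (measurable_softmax (η := η) hd).comp hZ
  have hae : (fun ω => softmax η (Z fun i => ζ i ω)) =ᵐ[μ] fun ω => softmax η (z t ω) := by
    filter_upwards [hzZ] with ω hω
    rw [hω]
  constructor
  · exact (hZs.comp_aemeasurable (aemeasurable_pi_lambda _ fun i => hζ i)).congr hae
  · have h1 := hind.indepFun_finset₀ (Finset.range t) {t} (by simp) hζ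
    have h2 := h1.comp hZs
      (measurable_pi_apply (⟨t, Finset.mem_singleton_self t⟩ : ({t} : Finset ℕ)))
    exact h2.congr hae Filter.EventuallyEq.rfl

end

/-! ### Numerical constants -/

lemma regret_constant_le (hd : 3 ≤ d) {T : ℕ} (hT : 1 ≤ T) {L η h : ℝ} (hL : 0 < L)
    (hη : η = (√6 + √12)⁻¹ * (√(Real.log d) / L) * √(1 / ((d : ℝ) * T)))
    (hh_le : h ≤ 7 * ((d : ℝ) + 1) * √(Real.log d) / (100 * √((d : ℝ) * T))) :
    Real.log d / η + T * (2 * η * (2 * L ^ 2 * d)) + T * (2 * L * h)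
      ≤ 11.9 * L * √((d : ℝ) * T * Real.log d) := by
  have hd3 : (3 : ℝ) ≤ d := by exact_mod_cast hd
  have hT1 : (1 : ℝ) ≤ T := by exact_mod_cast hT
  have hlog : 0 < Real.log d := Real.log_pos (by linarith)
  have hdT : 0 < (d : ℝ) * T := by positivity
  set s := √(Real.log d)
  set q := √((d : ℝ) * T)
  have hs : 0 < s := Real.sqrt_pos.2 hlog
  have hq : 0 < q := Real.sqrt_pos.2 hdT
  have hs2 : Real.log d = s ^ 2 := (Real.sq_sqrt hlog.le).symm
  have hq2 : (d : ℝ) * T = q ^ 2 := (Real.sq_sqrt hdT.le).symm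
  have hqs : √((d : ℝ) * T * Real.log d) = q * s := Real.sqrt_mul hdT.le _
  set A := √6 + √12
  have hA1 : 5.9 ≤ A := by
    have h1 : 2.44 ≤ √6 := Real.le_sqrt_of_sq_le (by norm_num)
    have h2 : 3.46 ≤ √12 := Real.le_sqrt_of_sq_le (by norm_num)
    linarith
  have hA2 : A ≤ 5.92 := by
    have h1 : √6 ≤ 2.45 := Real.sqrt_le_iff.2 (by norm_num)
    have h2 : √12 ≤ 3.47 := Real.sqrt_le_iff.2 (by norm_num)
    linarith
  have hA : 0 < A := by linarith
  have hη' : η = s / (A * L * q) := by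
    rw [hη, Real.sqrt_div zero_le_one, Real.sqrt_one]
    field_simp
    rfl
  have h1 : Real.log d / η = A * (L * (q * s)) := by
    rw [hη', hs2]; field_simp
  have h2 : T * (2 * η * (2 * L ^ 2 * d)) = 4 / A * (L * (q * s)) := by
    rw [hη']
    calc _ = 4 * s * L ^ 2 * ((d : ℝ) * T) / (A * L * q) := by ring
      _ = _ := by rw [hq2]; field_simp
  -- From `d ≥ 3`, `d + 1 ≤ 4 / 3 * d`, and `14 / 100 * (4 / 3) = 14 / 75`. In units of `L * (q *
  -- s)` the total is at most `5.92 + 0.7 + 14 / 75 < 6.9`, well below `11.9`.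
  have h3 : T * (2 * L * h) ≤ 14 / 75 * (L * (q * s)) := by
    calc T * (2 * L * h) ≤ T * (2 * L * (7 * ((d : ℝ) + 1) * s / (100 * q))) := by gcongr
      _ = 14 * L * s * (T * ((d : ℝ) + 1)) / (100 * q) := by ring
      _ ≤ 14 * L * s * (4 / 3 * q ^ 2) / (100 * q) := by
          have : (T : ℝ) * (d + 1) ≤ 4 / 3 * q ^ 2 := by rw [← hq2]; nlinarith
          gcongr
      _ = _ := by field_simp; ring
  have h4 : 4 / A ≤ 0.7 := by rw [div_le_iff₀ hA]; linarith
  have hP : 0 < L * (q * s) := by positivity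
  rw [h1, h2, hqs]
  have h5 := mul_le_mul_of_nonneg_right hA2 hP.le
  have h6 := mul_le_mul_of_nonneg_right h4 hP.le
  linarith

end ZeroOrder

end

/-! ### The regret bound -/

theorem corollary2 {Ω : Type*} [MeasurableSpace Ω] (μ : Measure Ω) [IsProbabilityMeasure μ]
    (d : ℕ) (hd : 3 ≤ d) (T : ℕ) (hT : 1 ≤ T) (L : ℝ) (hL : 0 < L)
    -- the losses, fixed in advance by the adversary
    (f : ℕ → EuclideanSpace ℝ (Fin d) → ℝ)
    (hconv : ∀ t, ConvexOn ℝ Set.univ (f t))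
    (hlip : ∀ t u v, |f t u - f t v| ≤ L * ZeroOrder.l1Norm (u - v))
    -- the randomization of the learner
    (ζ : ℕ → Ω → EuclideanSpace ℝ (Fin d))
    (hζ : ∀ t, HasLaw (ζ t) (ZeroOrder.uniformL1Sphere d) μ)
    (hind : iIndepFun ζ μ)
    -- canceling noise
    (ξ' ξ'' : ℕ → Ω → ℝ)
    (hξ : ∀ t, ∀ᵐ ω ∂μ, ξ' t ω = ξ'' t ω)
    -- the parameters
    (η h : ℝ)
    (hη : η = (√6 + √12)⁻¹ * (√(Real.log d) / L) * √(1 / ((d : ℝ) * T)))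
    (hh_pos : 0 < h)
    (hh_le : h ≤ 7 * ((d : ℝ) + 1) * √(Real.log d) / (100 * √((d : ℝ) * T)))
    -- a run of the algorithm on the simplex with the negative entropy
    (x g z : ℕ → Ω → EuclideanSpace ℝ (Fin d)) (y' y'' : ℕ → Ω → ℝ)
    (hrun : ∀ ω, ZeroOrder.IsTrajectory (ZeroOrder.simplex d) ZeroOrder.negEntropy
      (fun _ => η) (fun _ => h) f (fun t => ζ t ω) (fun t => ξ' t ω) (fun t => ξ'' t ω)
      (fun t => x t ω) (fun t => y' t ω) (fun t => y'' t ω) (fun t => g t ω) (fun t => z t ω)) :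
    ∀ u ∈ ZeroOrder.simplex d,
      Integrable (fun ω => ∑ t ∈ Finset.range T, (f t (x t ω) - f t u)) μ ∧
      ∫ ω, ∑ t ∈ Finset.range T, (f t (x t ω) - f t u) ∂μ
        ≤ 11.9 * L * √((d : ℝ) * T * Real.log d) := by
  intro u hu
  have hd0 : 0 < d := by omega
  have hd2 : 2 ≤ d := by omega
  have hη0 : 0 < η := by
    have hlog : 0 < Real.log d := Real.log_pos (by exact_mod_cast (by omega : 1 < d))
    rw [hη]
    positivity
  have hfm : ∀ t, Measurable (f t) := fun t =>
    (ZeroOrder.lipschitzWith_of_l1Norm hL.le (hlip t)).continuous.measurable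
  have hx : ∀ t ω, x t ω = ZeroOrder.softmax η (z t ω) := fun t ω =>
    ZeroOrder.eq_softmax_of_isMaxOn hd0 ((hrun ω).action_mem t) ((hrun ω).action_argmax t)
  have hxs : ∀ t ω, x t ω ∈ ZeroOrder.simplex d := fun t ω => (hrun ω).action_mem t
  have hg : ∀ t, ∀ᵐ ω ∂μ, g t ω
      = ZeroOrder.gradCoeff (f t) h (x t ω) (ζ t ω) • ZeroOrder.signVec (ζ t ω) := by
    intro t
    filter_upwards [hξ t] with ω hω
    have h1 := (hrun ω).gradient t
    have h2 := (hrun ω).query_fst t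
    have h3 := (hrun ω).query_snd t
    rw [h1, h2, h3, hω, ZeroOrder.gradCoeff, add_sub_add_right_eq_sub]
  have hindep := ZeroOrder.indepFun_softmax_dualVector (μ := μ) (f := f) (η := η) (h := h)
    (ζ := ζ) (z := z) hd0 hfm (fun t => (hζ t).aemeasurable) hind (fun ω => (hrun ω).init)
    (fun t => by
      filter_upwards [hg t] with ω hω
      rw [← hx, ← hω]
      exact (hrun ω).update t)
  simp only [← hx] at hindep
  have hint : ∀ t, Integrable (fun ω => f t (x t ω) - f t u) μ := fun t =>
    ZeroOrder.integrable_comp_sub hL.le (hlip t) (hindep t).1 (hxs t) hu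
  refine ⟨integrable_finsetSum _ fun t _ => hint t, ?_⟩
  have hinti := fun t => ZeroOrder.integrable_gradCoeff_mul_inner hL.le hh_pos (hlip t)
    (hindep t).1 (hxs t) (hζ t) hu
  have hints := fun t => ZeroOrder.integrable_gradCoeff_sq hL.le hh_pos (hlip t)
    (hindep t).1 (hζ t)
  have hpath : ∀ᵐ ω ∂μ, ∑ t ∈ Finset.range T, ZeroOrder.gradCoeff (f t) h (x t ω) (ζ t ω) *
        inner ℝ (ZeroOrder.signVec (ζ t ω)) (x t ω - u)
      ≤ Real.log d / η + ∑ t ∈ Finset.range T,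
        2 * η * ZeroOrder.gradCoeff (f t) h (x t ω) (ζ t ω) ^ 2 := by
    filter_upwards [ae_all_iff.2 hg] with ω hω
    have hreg := ZeroOrder.sum_inner_le_of_dualAveraging hd0 hη0 (z := fun t => z t ω)
      (g := fun t => g t ω)
      -- Every entry of the sign vector is `±1`, so all coordinates of `g t` have this absolute
      -- value.
      (γ := fun t => |ZeroOrder.gradCoeff (f t) h (x t ω) (ζ t ω)|) (hrun ω).init
      (hrun ω).update (fun t i => by
        simp only [hω t, PiLp.smul_apply, smul_eq_mul, abs_mul, ZeroOrder.abs_signVec_apply,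
          mul_one, le_refl]) hu T
    simp only [← hx, sq_abs, hω, real_inner_smul_left] at hreg
    exact hreg
  have hE := integral_mono_ae (integrable_finsetSum _ fun t _ => hinti t)
    ((integrable_const _).add (integrable_finsetSum _ fun t _ => (hints t).const_mul (2 * η)))
    hpath
  simp only [Pi.add_apply] at hE
  rw [integral_add (integrable_const _)
    (integrable_finsetSum _ fun t _ => (hints t).const_mul (2 * η)), integral_const, probReal_univ,
    one_smul, integral_finsetSum _ fun t _ => hinti t,
    integral_finsetSum _ fun t _ => (hints t).const_mul (2 * η)] at hE
  simp only [integral_const_mul] at hE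
  have hsq : ∑ t ∈ Finset.range T,
      2 * η * ∫ ω, ZeroOrder.gradCoeff (f t) h (x t ω) (ζ t ω) ^ 2 ∂μ
      ≤ T * (2 * η * (2 * L ^ 2 * d)) := by
    refine (Finset.sum_le_card_nsmul _ _ (2 * η * (2 * L ^ 2 * d)) fun t _ =>
      mul_le_mul_of_nonneg_left (ZeroOrder.integral_gradCoeff_sq_comp_le hd2 hL.le hh_pos (hlip t)
        (hindep t).1 (hζ t) (hindep t).2) (by positivity)).trans_eq ?_
    rw [Finset.card_range, nsmul_eq_mul]
  have hbias := Finset.sum_le_sum fun t (_ : t ∈ Finset.range T) =>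
    ZeroOrder.integral_comp_sub_le hd2 hL.le hh_pos (hconv t) (hlip t) (hindep t).1 (hxs t) (hζ t)
      (hindep t).2 hu
  rw [Finset.sum_add_distrib, Finset.sum_const, Finset.card_range, nsmul_eq_mul] at hbias
  rw [integral_finsetSum _ fun t _ => hint t]
  have hfinal := ZeroOrder.regret_constant_le hd hT hL hη hh_le
  linarith
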